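/- \textbf{Non-asymptotic bound for projected Sticky Track-and-Stop.} \emph{Setting.} Consider a one-parameter canonical exponential family on $\mathbb R$ parametrized by its means in an open set $\Theta\subseteq\mathbb R$; let $d(p,q)$ be the Kullback–Leibler divergence between the members with means $p,q$ (extended to $p\notin\Theta$ by the Legendre formula $d(p,q)=\sup_\theta\{(\theta-\nu_q)p-(b(\theta)-b(\nu_q))\}$, with $b$ the log-partition function and $\nu_q$ the natural parameter of the member with mean $q$). Assume that the family is sub-Gaussian, $d(p,q)\ge (p-q)^2/(2\sigma^2)$ for all $p,q\in\Theta$ with some $\sigma>0$, and that $[\mu_{\min},\mu_{\max}]\subset\Theta$. Let $K\ge 1$, let $\mathcal M\subseteq[\mu_{\min},\mu_{\max}]^K$ be a set of models, $\mathcal I$ a finite, totally ordered set of answers, and $i^\star(\boldsymbol\lambda)\subseteq\mathcal I$ the set (possibly with several elements) of correct answers for $\boldsymbol\lambda\in\mathcal M$. Write $\neg i=\{\boldsymbol\lambda\in\mathcal M: i\notin i^\star(\boldsymbol\lambda)\}$, let $\Delta_K$ be the probability simplex in $\mathbb R^K$, and put $\Gamma_i(\mathbf m,\boldsymbol\omega)=\inf_{\boldsymbol\lambda\in\neg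 i}\sum_{k}\omega_k d(m_k,\lambda_k)$ (with $\inf\emptyset=\infty$), $T^\star(\mathbf m)^{-1}=\sup_{\boldsymbol\omega\in\Delta_K}\max_{i\in\mathcal I}\Gamma_i(\mathbf m,\boldsymbol\omega)$, $i_F(\mathbf m)=\operatorname{argmax}_{i\in\mathcal I}\sup_{\boldsymbol\omega\in\Delta_K}\Gamma_i(\mathbf m,\boldsymbol\omega)$. \emph{Algorithm.} Fix $D_K\ge 1$. Let $A_t$ be the arm pulled and $X_t$ the observation in round $t$, $N_k(t)$ the number of pulls of arm $k$ in rounds $1,\dots,t$, $\hat{\boldsymbol\mu}(t)$ the vector of empirical means and $\tilde{\boldsymbol\mu}(t)$ its orthogonal projection onto $[\mu_{\min},\mu_{\max}]^K$. Each arm is pulled once in rounds $1,\dots,K$. For $t\ge K$, let $C_t=\{\boldsymbol\lambda\in\mathcal M:\sum_k N_k(t)d(\hat\mu_k(t),\lambda_k)\le D_K\log t\}$; the answer $i_t$ is the first element of $\bigcup_{\boldsymbol\lambda\in C_t} i_F(\boldsymbol\lambda)$ in the order of $\mathcal I$ (arbitrary if this set is empty); $\boldsymbol\omega(t)\in\operatorname{argmax}_{\boldsymbol\omega\in\Delta_K}\Gamma_{i_t}(\tilde{\boldsymbol\mu}(t),\boldsymbol\omega)$;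 $\tilde{\boldsymbol\omega}(t)$ is an $\ell_\infty$-projection of $\boldsymbol\omega(t)$ onto $\Delta_K\cap[\epsilon_t,1]^K$, $\epsilon_t=\tfrac12(K^2+t)^{-1/2}$; and $A_{t+1}\in\operatorname{argmax}_k\sum_{s=K}^t\tilde\omega_k(s)-N_k(t)$ (C-Tracking). The stopping time is $\tau_\delta=\inf\{t\ge K:\max_{i\in\mathcal I}\inf_{\boldsymbol\lambda\in\neg i}\sum_k N_k(t)d(\hat\mu_k(t),\lambda_k)\ge\beta_{t,\delta}\}$, where the threshold satisfies $\beta_{t,\delta}\ge 0$ and $t\mapsto\beta_{t,\delta}/t$ is nonincreasing on $t\ge 3$ for every $\delta\in(0,1)$ (for instance $\beta_{t,\delta}=\log\frac1\delta+K\log(4\log\frac1\delta+1)+6K\log(\log t+3)$). \emph{Theorem.} There are numbers $D_0(K)\ge 1$, depending on $K$ only, such that the following holds for every $D_K\ge D_0(K)$. Let $\boldsymbol\mu\in\mathcal M$, and let $\epsilon_{\boldsymbol\mu}>0$ be any number such that $i_F(\boldsymbol\mu')\subseteq i_F(\boldsymbol\mu)\cup(\mathcal I\setminus i^\star(\boldsymbol\mu))$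 for all $\boldsymbol\mu'\in\mathcal M$ with $\|\boldsymbol\mu-\boldsymbol\mu'\|_\infty\le\epsilon_{\boldsymbol\mu}$. Put $$T_{\boldsymbol\mu}=\max\Big\{10K^4,\ \inf\Big\{n\in\mathbb N:\ \sqrt{\sqrt n+K^2}>2K,\ \sqrt{\tfrac{8D_K\sigma^2\log n}{\sqrt{\sqrt n+K^2}-2K}}\le\epsilon_{\boldsymbol\mu}\Big\}\Big\}.$$ Then for every $\delta\in(0,1)$, when the arms have means $\boldsymbol\mu$, $$\mathbb E_{\boldsymbol\mu}[\tau_\delta]\le 10K^4+\frac{\pi^2}{24}+T_0(\delta),\qquad T_0(\delta)=\inf\big\{t\ge1:\ \beta_{t,\delta}\le(t-\sqrt t-1-T_{\boldsymbol\mu})\,T^\star(\boldsymbol\mu)^{-1}-g(t)\big\},$$ where $g$ is a nonnegative function that depends only on the family, $\sigma,\mu_{\min},\mu_{\max},K,D_K$, and satisfies, for all $t\ge 1$, $$g(t)\le C\,(1+\log(Kt))^{p}\Big(K^2\sqrt{D_K t}+\sqrt{D_K t^{3/2}}\Big)$$ with constants $C,p$ that depend only on the family, $\sigma$, $\mu_{\min}$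 and $\mu_{\max}$. -/

import Mathlib

open MeasureTheory ProbabilityTheory InformationTheory
open scoped ENNReal

noncomputable section

namespace StickyTaS

/-! ### One-parameter canonical exponential families -/

/-- A one-parameter canonical exponential family on `ℝ`, parametrized by its means.  With respect to
the reference measure `base` the member with natural parameter `θ` has density proportional to
`x ↦ exp (θ * x)`; `Θ` is an open set of means and `ν m` is the natural parameter of the member whose
mean is `m ∈ Θ`. -/
structure ExpFamily where
  base : Measure ℝ
  Θ : Set ℝ
  ν : ℝ → ℝ
  isOpen_Θ : IsOpen Θ
  ν_mem : ∀ m ∈ Θ, ν m ∈ interior (integrableExpSet id base)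
  mean_eq : ∀ m ∈ Θ, ∫ x, x ∂(base.tilted fun x => ν m * x) = m

namespace ExpFamily

/-- The member of the family with mean `m`. -/
def law (E : ExpFamily) (m : ℝ) : Measure ℝ :=
  E.base.tilted fun x => E.ν m * x

open Classical in
/-- The divergence `d(p, q)`: the Kullback-Leibler divergence between the members with means `p` and
`q` when `p ∈ Θ`.  An empirical mean may fall outside `Θ` (for Bernoulli arms it can be `0` or `1`);
there `d(p, q)` is given by the Legendre formula
`sup_θ {(θ - ν_q) p - (b(θ) - b(ν_q))}`, with `b` the log-partition function, which agrees with the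
Kullback-Leibler divergence for `p ∈ Θ` and is the usual extension. -/
def d (E : ExpFamily) (p q : ℝ) : ℝ≥0∞ :=
  if p ∈ E.Θ then klDiv (E.law p) (E.law q)
  else ⨆ θ ∈ integrableExpSet id E.base,
    ENNReal.ofReal ((θ - E.ν q) * p - (cgf id E.base θ - cgf id E.base (E.ν q)))

/-- Sub-Gaussian arms: `d(p, q) ≥ (p - q)² / (2σ²)` for all `p, q ∈ Θ`. -/
def SubGaussian (E : ExpFamily) (σ : ℝ) : Prop :=
  ∀ p ∈ E.Θ, ∀ q ∈ E.Θ, ENNReal.ofReal ((p - q) ^ 2 / (2 * σ ^ 2)) ≤ E.d p q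

end ExpFamily

/-! ### Pure exploration problems with possibly several correct answers -/

/-- A set `M` of bandit models (vectors of `K` means) together with the set-valued map `iStar` of
correct answers (only its values on `M` matter). -/
structure Problem (K : ℕ) (I : Type*) where
  M : Set (Fin K → ℝ)
  iStar : (Fin K → ℝ) → Set I

section Problem

variable {K : ℕ} {I : Type*} (E : ExpFamily) (Q : Problem K I)

/-- The set `¬ i` of models for which the answer `i` is not correct. -/
def Problem.alt (i : I) : Set (Fin K → ℝ) := {l ∈ Q.M | i ∉ Q.iStar l}

/-- `inf_{l ∈ ¬ i} ∑ k, w k * d(m k, l k)`; the infimum over the empty set is `∞`. -/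
def gain (m w : Fin K → ℝ) (i : I) : ℝ≥0∞ :=
  ⨅ l ∈ Q.alt i, ∑ k, ENNReal.ofReal (w k) * E.d (m k) (l k)

/-- `sup_{w ∈ Δ_K} inf_{l ∈ ¬ i} ∑ k, w k * d(m k, l k)`. -/
def value (m : Fin K → ℝ) (i : I) : ℝ≥0∞ :=
  ⨆ w ∈ stdSimplex ℝ (Fin K), gain E Q m w i

/-- `T*(m)⁻¹ = sup_{w ∈ Δ_K} max_i inf_{l ∈ ¬ i} ∑ k, w k * d(m k, l k)`. -/
def invTStar (m : Fin K → ℝ) : ℝ≥0∞ :=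
  ⨆ w ∈ stdSimplex ℝ (Fin K), ⨆ i, gain E Q m w i

/-- `i_F(m)`: the answers `i` that maximize `sup_w inf_{l ∈ ¬ i} ∑ k, w k * d(m k, l k)`. -/
def iF (m : Fin K → ℝ) : Set I := {i | ∀ j, value E Q m j ≤ value E Q m i}

/-- `w*(m, ¬ i)`: the oracle weights for the answer `i`. -/
def oracleWeights (m : Fin K → ℝ) (i : I) : Set (Fin K → ℝ) :=
  {w ∈ stdSimplex ℝ (Fin K) | ∀ v ∈ stdSimplex ℝ (Fin K), gain E Q m v i ≤ gain E Q m w i}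

end Problem

/-! ### Statistics of a sequence of actions and observations

Rounds are numbered `1, 2, …`; `a t` is the action and `x t` the observation of round `t`. -/

section Path

variable {K : ℕ} {I : Type*}

/-- `N_k(t)`. -/
def pulls (a : ℕ → Fin K) (k : Fin K) (t : ℕ) : ℕ := {s ∈ Finset.Icc 1 t | a s = k}.card

/-- The vector of empirical means at time `t`. -/
def empMean (a : ℕ → Fin K) (x : ℕ → ℝ) (t : ℕ) (k : Fin K) : ℝ :=
  (∑ s ∈ Finset.Icc 1 t with a s = k, x s) / (pulls a k t : ℝ)

/-- The orthogonal projection of the empirical means onto `[μmin, μmax]^K`. -/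
def projMean (μmin μmax : ℝ) (a : ℕ → Fin K) (x : ℕ → ℝ) (t : ℕ) (k : Fin K) : ℝ :=
  max μmin (min μmax (empMean a x t k))

/-- The confidence region `C_t = {l ∈ M : ∑ k, N_k(t) d(μ̂_k(t), l_k) ≤ D_K log t}`. -/
def confRegion (E : ExpFamily) (Q : Problem K I) (DK : ℝ) (a : ℕ → Fin K) (x : ℕ → ℝ) (t : ℕ) :
    Set (Fin K → ℝ) :=
  {l ∈ Q.M | ∑ k, (pulls a k t : ℝ≥0∞) * E.d (empMean a x t k) (l k)
    ≤ ENNReal.ofReal (DK * Real.log t)}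

/-- The set of candidate answers, the union of `i_F(l)` over `l ∈ C_t`. -/
def candidates (E : ExpFamily) (Q : Problem K I) (DK : ℝ) (a : ℕ → Fin K) (x : ℕ → ℝ) (t : ℕ) :
    Set I :=
  ⋃ l ∈ confRegion E Q DK a x t, iF E Q l

/-- The forced exploration level `ε_t = (K² + t)^(-1/2) / 2`. -/
def explore (K t : ℕ) : ℝ := (Real.sqrt ((K : ℝ) ^ 2 + t))⁻¹ / 2

/-- `Δ_K ∩ [ε, 1]^K`. -/
def truncSimplex (K : ℕ) (ε : ℝ) : Set (Fin K → ℝ) :=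
  {w ∈ stdSimplex ℝ (Fin K) | ∀ k, w k ∈ Set.Icc ε 1}

/-- `v` is a projection of `w` onto `S` for the sup norm (`dist` on `Fin K → ℝ` is the sup distance). -/
def IsSupProj (S : Set (Fin K → ℝ)) (w v : Fin K → ℝ) : Prop :=
  v ∈ S ∧ ∀ u ∈ S, dist w v ≤ dist w u

/-- The sequence of actions `a` and observations `x` is one of projected Sticky Track-and-Stop:
every arm is pulled once in the first `K` rounds; at every `t ≥ K` an answer `ans t` is selected as
the first candidate answer in the given total order of the answers (it is arbitrary when there is no
candidate), weights `w t` are oracle weights for this answer at the projected empirical means, `wt t`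
is the sup norm projection of `w t` onto `Δ_K ∩ [ε_t, 1]^K`, and the next action is given by
C-Tracking. -/
def FollowsStickyTaS [LinearOrder I] (E : ExpFamily) (Q : Problem K I) (μmin μmax DK : ℝ)
    (a : ℕ → Fin K) (x : ℕ → ℝ) : Prop :=
  (∀ k, pulls a k K = 1) ∧
  ∃ (ans : ℕ → I) (w wt : ℕ → Fin K → ℝ), ∀ t, K ≤ t →
    ((candidates E Q DK a x t).Nonempty → IsLeast (candidates E Q DK a x t) (ans t)) ∧
    w t ∈ oracleWeights E Q (projMean μmin μmax a x t) (ans t) ∧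
    IsSupProj (truncSimplex K (explore K t)) (w t) (wt t) ∧
    ∀ k, ∑ s ∈ Finset.Icc K t, wt s k - (pulls a k t : ℝ)
      ≤ ∑ s ∈ Finset.Icc K t, wt s (a (t + 1)) - (pulls a (a (t + 1)) t : ℝ)

/-- The statistic `max_i inf_{l ∈ ¬ i} ∑ k, N_k(t) d(μ̂_k(t), l_k)` of the stopping rule. -/
def stopStat (E : ExpFamily) (Q : Problem K I) (a : ℕ → Fin K) (x : ℕ → ℝ) (t : ℕ) : ℝ≥0∞ :=
  ⨆ i, gain E Q (empMean a x t) (fun k => (pulls a k t : ℝ)) i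

/-- The stopping time: the first `t ≥ K` at which the statistic reaches the threshold `b t`
(`∞` if there is none). -/
def stopTime (E : ExpFamily) (Q : Problem K I) (b : ℕ → ℝ) (a : ℕ → Fin K) (x : ℕ → ℝ) : ℝ≥0∞ :=
  ⨅ (t : ℕ) (_ : K ≤ t ∧ ENNReal.ofReal (b t) ≤ stopStat E Q a x t), (t : ℝ≥0∞)

end Path

/-! ### The stochastic interaction -/

/-- Actions `A` and observations `X` of a learner that faces the arms with laws `φ k`: with respect to
a filtration `ℱ` of available information, the action of round `t + 1` is known after round `t`, and
given the information of round `t` the next observation has the law of the arm that is pulled. -/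
structure IsInteraction {Ω : Type*} {mΩ : MeasurableSpace Ω} (P : Measure Ω) {K : ℕ}
    (φ : Fin K → Measure ℝ) (ℱ : Filtration ℕ mΩ) (A : ℕ → Ω → Fin K) (X : ℕ → Ω → ℝ) : Prop where
  action : ∀ t, Measurable[ℱ t] (A (t + 1))
  observation : ∀ t, Measurable[ℱ (t + 1)] (X (t + 1))
  law : ∀ t, ∀ B : Set ℝ, MeasurableSet B →
    P⟦X (t + 1) ⁻¹' B | ℱ t⟧ =ᵐ[P] fun ω => (φ (A (t + 1) ω)).real B

/-! ### The quantities in the bound -/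

/-- A stopping threshold: nonnegative, with `β_{t,δ} / t` nonincreasing in `t ≥ 3`, for all
`δ ∈ (0, 1)`.  Logarithmic thresholds such as
`log (1/δ) + K log (4 log (1/δ) + 1) + 6 K log (log t + 3)` and `log (1/δ) + K log t` are of this
kind. -/
structure IsThreshold (β : ℕ → ℝ → ℝ) : Prop where
  nonneg : ∀ δ ∈ Set.Ioo (0 : ℝ) 1, ∀ t : ℕ, 0 ≤ β t δ
  antitone : ∀ δ ∈ Set.Ioo (0 : ℝ) 1, ∀ s t : ℕ, 3 ≤ s → s ≤ t → β t δ / t ≤ β s δ / s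

/-- `T_μ = max {10 K⁴, inf {n : √(8 D_K σ² log n / (√(√n + K²) - 2K)) ≤ ε}}`, where `n` runs over the
integers for which the denominator is positive. -/
def Tmu (K : ℕ) (σ DK ε : ℝ) : ℕ :=
  max (10 * K ^ 4) (sInf {n : ℕ | 0 < √(√n + (K : ℝ) ^ 2) - 2 * K ∧
    √(8 * DK * σ ^ 2 * Real.log n / (√(√n + (K : ℝ) ^ 2) - 2 * K)) ≤ ε})

/-- `T_0 = inf {t ≥ 1 : b t ≤ (t - √t - 1 - T) * R - g t}` (`∞` if there is no such `t`). -/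
def T0 (b g : ℕ → ℝ) (T : ℕ) (R : ℝ≥0∞) : ℝ≥0∞ :=
  ⨅ (t : ℕ) (_ : 1 ≤ t ∧
    ((b t : ℝ) : EReal) ≤ (((t : ℝ) - √t - 1 - T : ℝ) : EReal) * (R : EReal) - ((g t : ℝ) : EReal)),
    (t : ℝ≥0∞)

end StickyTaS

end

open StickyTaS

/-! Call round s good if μ lies in the confidence region `C_s`, bad otherwise. The core is a
pathwise bound (`ofReal_le_stopStat`): if all rounds from √t to t are good and T_μ < t - √t - 1, the
stopping statistic at t is at least (t - √t - 1 - T_μ) T*(μ)⁻¹ - g(t).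

It holds because forced exploration gives N_k(s) ≥ √(s + K²) - 2K, so by sub-Gaussianity every model
of `C_s` is within ρ_s = `confRadius` of the projected empirical means, and 2ρ_s ≤ ε for s ≥ T_μ.
Hence the selected answer is an oracle answer of a model ε-close to μ. By the choice of ε it is
either an oracle answer of μ, and then the first one since all of them are candidates (stickiness),
or incorrect for μ, and then T*(μ)⁻¹ is itself O(ρ_s). As d is Lipschitz in its first argument on
the box, in both cases the weights of round s gain T*(μ)⁻¹ - O(ρ_s) against one fixed answer
(`invTStar_le_sum_add`). Summing over rounds costs √(D_K t^(3/2) log t) by Cauchy-Schwarz; replacing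
weights by pulls costs O(K²√t) by C-Tracking.

Divided by t, this lower bound increases while the threshold decreases, so the condition in `T0`,
once true at t₀, stays true. If s is the last bad round, the window of t₀ + s² + 1 starts after s,
so τ ≤ t₀ + ∑ (s² + 1) over bad s (`stopTime_le_add_tsum`). Chernoff bounds with D_K ≥ 6K make round
s ≥ 2K bad with probability at most s⁻⁴ (`measure_not_sum_le`), and the expected sum is at most 10 ≤
10K⁴. -/

namespace StickyTaS
-- Exponential families: Legendre duality and regularity of the divergence.
namespace ExpFamily

variable (E : ExpFamily) {p q θ : ℝ}

/-- The Legendre functional `(θ - ν_q) p - (b(θ) - b(ν_q))`. -/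
noncomputable def legendre (θ p q : ℝ) : ℝ :=
  (θ - E.ν q) * p - (cgf id E.base θ - cgf id E.base (E.ν q))

/-- Under the zero measure every mean would be 0, forcing Θ = {0}, which is not open. -/
lemma base_ne_zero (hp : p ∈ E.Θ) : E.base ≠ 0 := by
  intro h0
  have h : ∀ m ∈ E.Θ, m = 0 := fun m hm => by
    have := E.mean_eq m hm
    simpa [h0] using this.symm
  have hp0 := h p hp
  subst hp0
  have hsub : E.Θ = {0} := Set.eq_singleton_iff_unique_mem.2 ⟨hp, h⟩
  exact not_isOpen_singleton (0 : ℝ) (hsub ▸ E.isOpen_Θ)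

lemma integrable_exp_of_mem (hθ : θ ∈ integrableExpSet id E.base) :
    Integrable (fun x => Real.exp (θ * x)) E.base := hθ

lemma ν_mem_dom (hp : p ∈ E.Θ) : E.ν p ∈ integrableExpSet id E.base :=
  interior_subset (E.ν_mem p hp)

lemma isProbabilityMeasure_law (hp : p ∈ E.Θ) : IsProbabilityMeasure (E.law p) :=
  haveI : NeZero E.base := ⟨E.base_ne_zero hp⟩
  isProbabilityMeasure_tilted (E.integrable_exp_of_mem (E.ν_mem_dom hp))

lemma integrable_id_law (hp : p ∈ E.Θ) : Integrable (fun x : ℝ => x) (E.law p) := by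
  have h := memLp_tilted_mul (X := (id : ℝ → ℝ)) (E.ν_mem p hp) 1
  exact memLp_one_iff_integrable.1 h

lemma integral_id_law (hp : p ∈ E.Θ) : ∫ x, x ∂(E.law p) = p := E.mean_eq p hp

lemma integral_exp_pos_of_mem (hp : p ∈ E.Θ) (hθ : θ ∈ integrableExpSet id E.base) :
    0 < ∫ x, Real.exp (θ * x) ∂E.base :=
  haveI : NeZero E.base := ⟨E.base_ne_zero hp⟩
  integral_exp_pos (E.integrable_exp_of_mem hθ)

lemma integral_exp_law (hp : p ∈ E.Θ) (hθ : θ ∈ integrableExpSet id E.base) :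
    ∫ x, Real.exp ((θ - E.ν p) * x) ∂(E.law p)
      = Real.exp (cgf id E.base θ - cgf id E.base (E.ν p)) := by
  have h1 := E.integral_exp_pos_of_mem hp hθ
  have h2 := E.integral_exp_pos_of_mem hp (E.ν_mem_dom hp)
  have h := integral_exp_tilted (μ := E.base) (fun x => E.ν p * x) (fun x => (θ - E.ν p) * x)
  rw [law, h, Real.exp_sub, cgf, cgf, mgf, mgf]
  simp only [id]
  rw [Real.exp_log h1, Real.exp_log h2]
  congr 2
  ext x
  simp only [Pi.add_apply]
  ring_nf

lemma integrable_exp_law (hp : p ∈ E.Θ) (hθ : θ ∈ integrableExpSet id E.base) :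
    Integrable (fun x => Real.exp ((θ - E.ν p) * x)) (E.law p) := by
  refine (integrable_tilted_iff (E.integrable_exp_of_mem (E.ν_mem_dom hp)) _).2 ?_
  refine (E.integrable_exp_of_mem hθ).congr (ae_of_all _ fun x => ?_)
  simp only [smul_eq_mul, ← Real.exp_add]
  ring_nf

/-- The log-partition function lies above its tangents. -/
lemma mul_le_cgf_sub (hp : p ∈ E.Θ) (hθ : θ ∈ integrableExpSet id E.base) :
    (θ - E.ν p) * p ≤ cgf id E.base θ - cgf id E.base (E.ν p) := by
  have := E.isProbabilityMeasure_law hp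
  have hi := E.integrable_exp_law hp hθ
  have hid := E.integrable_id_law hp
  set c := (θ - E.ν p) * p
  -- Jensen's inequality for exp, obtained by integrating its tangent at c, the mean of the
  -- exponent.
  have key : Real.exp c ≤ ∫ x, Real.exp ((θ - E.ν p) * x) ∂(E.law p) := by
    have hle : ∫ x, Real.exp c * (1 + ((θ - E.ν p) * x - c)) ∂(E.law p)
        ≤ ∫ x, Real.exp ((θ - E.ν p) * x) ∂(E.law p) := by
      refine integral_mono ?_ hi fun x => ?_
      · exact ((integrable_const 1).add ((hid.const_mul _).sub (integrable_const c))).const_mul _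
      · have h := Real.add_one_le_exp ((θ - E.ν p) * x - c)
        calc Real.exp c * (1 + ((θ - E.ν p) * x - c))
            ≤ Real.exp c * Real.exp ((θ - E.ν p) * x - c) := by gcongr; linarith
          _ = Real.exp ((θ - E.ν p) * x) := by rw [← Real.exp_add]; ring_nf
    have heq : ∫ x, Real.exp c * (1 + ((θ - E.ν p) * x - c)) ∂(E.law p) = Real.exp c := by
      have h1 : ∫ x, ((θ - E.ν p) * x - c) ∂(E.law p) = 0 := by
        rw [integral_sub (hid.const_mul _) (integrable_const c), integral_const_mul,
          E.integral_id_law hp]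
        simp [c]
      have h2 : ∫ x, (1 + ((θ - E.ν p) * x - c)) ∂(E.law p) = 1 := by
        rw [integral_add (integrable_const 1) (f := fun _ => (1 : ℝ))
          (g := fun x => (θ - E.ν p) * x - c) ((hid.const_mul _).sub (integrable_const c)), h1]
        simp
      rw [integral_const_mul, h2, mul_one]
    rwa [heq] at hle
  rw [E.integral_exp_law hp hθ] at key
  exact Real.exp_le_exp.1 key

lemma law_tilted (hp : p ∈ E.Θ) (q : ℝ) :
    E.law q = (E.law p).tilted fun x => (E.ν q - E.ν p) * x := by
  rw [law, law, tilted_tilted (E.integrable_exp_of_mem (E.ν_mem_dom hp))]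
  congr 1
  ext x
  simp only [Pi.add_apply]
  ring

/-- The log-likelihood ratio is affine in x, so its integral is its value at the mean p. -/
lemma klDiv_law (hp : p ∈ E.Θ) (hq : q ∈ E.Θ) :
    klDiv (E.law p) (E.law q) = ENNReal.ofReal (E.legendre (E.ν p) p q) := by
  have := E.isProbabilityMeasure_law hp
  have := E.isProbabilityMeasure_law hq
  have hac : E.law p ≪ E.law q := by
    rw [E.law_tilted hq p]; exact tilted_absolutelyContinuous _ _
  have hllr : llr (E.law p) (E.law q) =ᵐ[E.law p] fun x => (E.ν p - E.ν q) * x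
      - (cgf id E.base (E.ν p) - cgf id E.base (E.ν q)) := by
    refine hac.ae_le ?_
    have h := log_rnDeriv_tilted_left_self (μ := E.law q)
      (E.integrable_exp_law hq (E.ν_mem_dom hp))
    rw [← E.law_tilted hq p] at h
    filter_upwards [h] with x hx
    rw [llr, hx, E.integral_exp_law hq (E.ν_mem_dom hp), Real.log_exp]
  have hint : Integrable (fun x => (E.ν p - E.ν q) * x
      - (cgf id E.base (E.ν p) - cgf id E.base (E.ν q))) (E.law p) :=
    ((E.integrable_id_law hp).const_mul _).sub (integrable_const _)
  rw [klDiv_of_ac_of_integrable hac ((integrable_congr hllr).2 hint), integral_congr_ae hllr,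
    integral_sub ((E.integrable_id_law hp).const_mul _) (integrable_const _),
    integral_const_mul, E.integral_id_law hp]
  simp [legendre]

lemma d_of_mem (hp : p ∈ E.Θ) (hq : q ∈ E.Θ) :
    E.d p q = ENNReal.ofReal (E.legendre (E.ν p) p q) := by
  rw [d, if_pos hp, E.klDiv_law hp hq]

/-- With `exists_lt_legendre`, this lets d be treated as a supremum over tilts whether or not p ∈ Θ:
inside Θ the tangent inequality makes ν p optimal. -/
lemma legendre_le_d (hq : q ∈ E.Θ) (hθ : θ ∈ integrableExpSet id E.base) (p : ℝ) :
    ENNReal.ofReal (E.legendre θ p q) ≤ E.d p q := by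
  by_cases hp : p ∈ E.Θ
  · rw [E.d_of_mem hp hq]
    refine ENNReal.ofReal_le_ofReal ?_
    have := E.mul_le_cgf_sub hp hθ
    simp only [legendre]
    linarith
  · rw [d, if_neg hp]
    exact le_iSup₂_of_le (f := fun θ (_ : θ ∈ integrableExpSet id E.base) =>
      ENNReal.ofReal ((θ - E.ν q) * p - (cgf id E.base θ - cgf id E.base (E.ν q)))) θ hθ le_rfl

lemma exists_lt_legendre (hq : q ∈ E.Θ) {y : ℝ≥0∞} (hy : y < E.d p q) :
    ∃ θ ∈ integrableExpSet id E.base, y < ENNReal.ofReal (E.legendre θ p q) := by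
  by_cases hp : p ∈ E.Θ
  · exact ⟨E.ν p, E.ν_mem_dom hp, by rwa [← E.d_of_mem hp hq]⟩
  · rw [d, if_neg hp] at hy
    obtain ⟨θ, h⟩ := lt_iSup_iff.1 hy
    obtain ⟨hθ, h⟩ := lt_iSup_iff.1 h
    exact ⟨θ, hθ, h⟩

lemma legendre_nonneg (hp : p ∈ E.Θ) (hq : q ∈ E.Θ) : 0 ≤ E.legendre (E.ν p) p q := by
  have := E.mul_le_cgf_sub hp (E.ν_mem_dom hq)
  simp only [legendre]
  linarith

lemma d_ne_top (hp : p ∈ E.Θ) (hq : q ∈ E.Θ) : E.d p q ≠ ∞ := by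
  rw [E.d_of_mem hp hq]; exact ENNReal.ofReal_ne_top

lemma toReal_d (hp : p ∈ E.Θ) (hq : q ∈ E.Θ) : (E.d p q).toReal = E.legendre (E.ν p) p q := by
  rw [E.d_of_mem hp hq, ENNReal.toReal_ofReal (E.legendre_nonneg hp hq)]

lemma d_self (hp : p ∈ E.Θ) : E.d p p = 0 := by
  rw [E.d_of_mem hp hp]; simp [legendre]

/-- The natural parameter is a monotone function of the mean. -/
lemma ν_mono (hp : p ∈ E.Θ) (hq : q ∈ E.Θ) (h : p ≤ q) : E.ν p ≤ E.ν q := by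
  rcases h.eq_or_lt with rfl | h
  · exact le_rfl
  have h1 := E.mul_le_cgf_sub hp (E.ν_mem_dom hq)
  have h2 := E.mul_le_cgf_sub hq (E.ν_mem_dom hp)
  by_contra! hc
  nlinarith [mul_pos (sub_pos.2 h) (sub_pos.2 hc)]

section Box

variable {E} {a b p p' q : ℝ}

/-- On a compact interval of means the divergence is Lipschitz in its first argument. -/
lemma toReal_d_le_add (hΘ : Set.Icc a b ⊆ E.Θ) (hp : p ∈ Set.Icc a b)
    (hp' : p' ∈ Set.Icc a b) (hq : q ∈ Set.Icc a b) :
    (E.d p q).toReal ≤ (E.d p' q).toReal + |E.ν b - E.ν a| * |p - p'| := by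
  have ha : a ∈ E.Θ := hΘ ⟨le_rfl, hp.1.trans hp.2⟩
  have hb : b ∈ E.Θ := hΘ ⟨hp.1.trans hp.2, le_rfl⟩
  have hbd : ∀ r ∈ Set.Icc a b, E.ν a ≤ E.ν r ∧ E.ν r ≤ E.ν b := fun r hr =>
    ⟨E.ν_mono ha (hΘ hr) hr.1, E.ν_mono (hΘ hr) hb hr.2⟩
  rw [E.toReal_d (hΘ hp) (hΘ hq), E.toReal_d (hΘ hp') (hΘ hq)]
  -- The tilt ν p is suboptimal for p', and for this fixed tilt the functional is affine in the mean
  -- with slope ν p - ν q.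
  have h1 := E.mul_le_cgf_sub (hΘ hp') (E.ν_mem_dom (hΘ hp))
  have h2 : |E.ν p - E.ν q| ≤ |E.ν b - E.ν a| := by
    have := hbd p hp
    have := hbd q hq
    rw [abs_le, abs_of_nonneg (by linarith)]
    constructor <;> linarith
  have h3 : (E.ν p - E.ν q) * (p - p') ≤ |E.ν b - E.ν a| * |p - p'| :=
    (le_abs_self _).trans (by rw [abs_mul]; gcongr)
  simp only [legendre]
  linarith

lemma toReal_d_le (hΘ : Set.Icc a b ⊆ E.Θ) (hp : p ∈ Set.Icc a b) (hq : q ∈ Set.Icc a b) :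
    (E.d p q).toReal ≤ |E.ν b - E.ν a| * |b - a| := by
  have h := toReal_d_le_add hΘ hp hq hq
  rw [E.d_self (hΘ hq)] at h
  refine h.trans ?_
  rw [ENNReal.toReal_zero, zero_add]
  have hab : a ≤ b := hp.1.trans hp.2
  refine mul_le_mul_of_nonneg_left ?_ (abs_nonneg _)
  rw [abs_le, abs_of_nonneg (by linarith)]
  constructor <;> linarith [hp.1, hp.2, hq.1, hq.2]

/-- Projecting the first argument onto an interval that contains the second argument decreases the
divergence. -/
lemma d_proj_le (hΘ : Set.Icc a b ⊆ E.Θ) (hq : q ∈ Set.Icc a b) (p : ℝ) :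
    E.d (max a (min b p)) q ≤ E.d p q := by
  have ha : a ∈ E.Θ := hΘ ⟨le_rfl, hq.1.trans hq.2⟩
  have hb : b ∈ E.Θ := hΘ ⟨hq.1.trans hq.2, le_rfl⟩
  have hab : a ≤ b := hq.1.trans hq.2
  rcases le_total b p with h | h
  · rw [min_eq_left h, max_eq_right hab, E.d_of_mem hb (hΘ hq)]
    -- With the tilt ν b the Legendre functional has slope ν b - ν q ≥ 0 in the mean, so it only
    -- grows from b to p.
    refine le_trans (ENNReal.ofReal_le_ofReal ?_) (E.legendre_le_d (hΘ hq) (E.ν_mem_dom hb) p)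
    have := mul_le_mul_of_nonneg_left h (sub_nonneg.2 (E.ν_mono (hΘ hq) hb hq.2))
    simp only [legendre]
    linarith
  · rw [min_eq_right h]
    rcases le_total p a with h' | h'
    · rw [max_eq_left h', E.d_of_mem ha (hΘ hq)]
      refine le_trans (ENNReal.ofReal_le_ofReal ?_) (E.legendre_le_d (hΘ hq) (E.ν_mem_dom ha) p)
      have := mul_le_mul_of_nonpos_left h' (sub_nonpos.2 (E.ν_mono ha (hΘ hq) hq.1))
      simp only [legendre]
      linarith
    · rw [max_eq_right h']

lemma proj_mem (hab : a ≤ b) (p : ℝ) : max a (min b p) ∈ Set.Icc a b :=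
  ⟨le_max_left _ _, max_le hab (min_le_left _ _)⟩

end Box

end ExpFamily
-- Pull counts and sums of rewards.
section Counting

variable {K : ℕ}

/-- The sum of the observations of arm `k` in rounds `1, …, t`. -/
noncomputable def armSum (a : ℕ → Fin K) (x : ℕ → ℝ) (k : Fin K) (t : ℕ) : ℝ :=
  ∑ s ∈ Finset.Icc 1 t with a s = k, x s

lemma pulls_zero (a : ℕ → Fin K) (k : Fin K) : pulls a k 0 = 0 := by simp [pulls]

lemma armSum_zero (a : ℕ → Fin K) (x : ℕ → ℝ) (k : Fin K) : armSum a x k 0 = 0 := by simp [armSum]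

lemma pulls_eq_sum (a : ℕ → Fin K) (k : Fin K) (t : ℕ) :
    pulls a k t = ∑ s ∈ Finset.Icc 1 t, if a s = k then 1 else 0 := by
  exact Finset.card_filter _ _

lemma armSum_eq_sum (a : ℕ → Fin K) (x : ℕ → ℝ) (k : Fin K) (t : ℕ) :
    armSum a x k t = ∑ s ∈ Finset.Icc 1 t, if a s = k then x s else 0 := by
  simp [armSum, Finset.sum_filter]

lemma pulls_succ (a : ℕ → Fin K) (k : Fin K) (t : ℕ) :
    pulls a k (t + 1) = pulls a k t + if a (t + 1) = k then 1 else 0 := by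
  rw [pulls_eq_sum, pulls_eq_sum, Finset.sum_Icc_succ_top (by omega)]

lemma armSum_succ (a : ℕ → Fin K) (x : ℕ → ℝ) (k : Fin K) (t : ℕ) :
    armSum a x k (t + 1) = armSum a x k t + if a (t + 1) = k then x (t + 1) else 0 := by
  rw [armSum_eq_sum, armSum_eq_sum, Finset.sum_Icc_succ_top (by omega)]

lemma pulls_le (a : ℕ → Fin K) (k : Fin K) (t : ℕ) : pulls a k t ≤ t :=
  (Finset.card_filter_le _ _).trans (by simp)

lemma sum_pulls (a : ℕ → Fin K) (t : ℕ) : ∑ k, pulls a k t = t := by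
  simp_rw [pulls_eq_sum]
  rw [Finset.sum_comm]
  simp

end Counting

/-! ### Conditional laws and the exponential martingale. -/

namespace IsInteraction

variable {Ω : Type*} {mΩ : MeasurableSpace Ω} {P : Measure Ω} {K : ℕ}
  {φ : Fin K → Measure ℝ} {ℱ : Filtration ℕ mΩ} {A : ℕ → Ω → Fin K} {X : ℕ → Ω → ℝ}

lemma measurableSet_action (h : IsInteraction P φ ℱ A X) (t : ℕ) (k : Fin K) :
    MeasurableSet[ℱ t] {ω | A (t + 1) ω = k} :=
  h.action t (measurableSet_singleton k)

lemma measurable_pulls (h : IsInteraction P φ ℱ A X) (k : Fin K) (t : ℕ) :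
    Measurable[ℱ t] fun ω => pulls (fun s => A s ω) k t := by
  simp_rw [pulls_eq_sum]
  refine Finset.measurable_sum _ fun s hs => ?_
  obtain ⟨u, rfl⟩ : ∃ u, s = u + 1 := ⟨s - 1, by have := (Finset.mem_Icc.1 hs).1; omega⟩
  have hu : u ≤ t := by have := (Finset.mem_Icc.1 hs).2; omega
  exact Measurable.ite (ℱ.mono hu _ (h.measurableSet_action u k)) measurable_const measurable_const

lemma measurable_armSum (h : IsInteraction P φ ℱ A X) (k : Fin K) (t : ℕ) :
    Measurable[ℱ t] fun ω => armSum (fun s => A s ω) (fun s => X s ω) k t := by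
  simp_rw [armSum_eq_sum]
  refine Finset.measurable_sum _ fun s hs => ?_
  obtain ⟨u, rfl⟩ : ∃ u, s = u + 1 := ⟨s - 1, by have := (Finset.mem_Icc.1 hs).1; omega⟩
  have hu : u + 1 ≤ t := (Finset.mem_Icc.1 hs).2
  exact Measurable.ite (ℱ.mono (by omega) _ (h.measurableSet_action u k))
    ((h.observation u).mono (ℱ.mono hu) le_rfl) measurable_const

lemma measure_inter_preimage [IsProbabilityMeasure P] (h : IsInteraction P φ ℱ A X)
    [∀ k, IsProbabilityMeasure (φ k)]
    (t : ℕ) (k : Fin K) {F : Set Ω} (hF : MeasurableSet[ℱ t] F) (hFk : F ⊆ {ω | A (t + 1) ω = k})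
    {B : Set ℝ} (hB : MeasurableSet B) :
    P (X (t + 1) ⁻¹' B ∩ F) = P F * φ k B := by
  have hX : Measurable (X (t + 1)) := (h.observation t).mono (ℱ.le _) le_rfl
  have hF' : MeasurableSet F := ℱ.le t _ hF
  have hpre : MeasurableSet (X (t + 1) ⁻¹' B) := hX hB
  have h1 := setIntegral_condExp (μ := P) (ℱ.le t)
    (f := (X (t + 1) ⁻¹' B).indicator fun _ => (1 : ℝ))
    ((integrable_const 1).indicator hpre) hF
  have h2 : ∫ ω in F, (P⟦X (t + 1) ⁻¹' B | ℱ t⟧) ω ∂P = ∫ ω in F, (φ k).real B ∂P := by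
    refine setIntegral_congr_ae hF' ?_
    filter_upwards [h.law t B hB] with ω hω hωF
    rw [hω, hFk hωF]
  rw [h2, setIntegral_const, setIntegral_indicator hpre, setIntegral_const] at h1
  simp only [smul_eq_mul, mul_one] at h1
  rw [Set.inter_comm, ← ENNReal.toReal_eq_toReal_iff' (by finiteness) (by finiteness),
    ENNReal.toReal_mul]
  exact h1.symm

/-- Given the past, the observation of an arm is distributed as the law of the arm. -/
lemma setLIntegral_mul [IsProbabilityMeasure P] (h : IsInteraction P φ ℱ A X)
    [∀ k, IsProbabilityMeasure (φ k)]
    (t : ℕ) (k : Fin K) {g : Ω → ℝ≥0∞} (hg : Measurable[ℱ t] g) {f : ℝ → ℝ≥0∞}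
    (hf : Measurable f) :
    ∫⁻ ω in {ω | A (t + 1) ω = k}, f (X (t + 1) ω) * g ω ∂P
      = (∫⁻ x, f x ∂(φ k)) * ∫⁻ ω in {ω | A (t + 1) ω = k}, g ω ∂P := by
  have hX : Measurable (X (t + 1)) := (h.observation t).mono (ℱ.le _) le_rfl
  set S := {ω | A (t + 1) ω = k}
  have hS : MeasurableSet[ℱ t] S := h.measurableSet_action t k
  set Q := P.restrict S
  have hfX : Measurable fun ω => f (X (t + 1) ω) := hf.comp hX
  -- Restricted to the past, weighting by f(X) only multiplies the measure by a constant;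
  -- integrating g against both trimmed measures then gives the claim.
  have htrim : (Q.withDensity fun ω => f (X (t + 1) ω)).trim (ℱ.le t)
      = ((∫⁻ x, f x ∂(φ k)) • Q).trim (ℱ.le t) := by
    refine @Measure.ext _ (ℱ t) _ _ fun F hF => ?_
    have hF' : MeasurableSet F := ℱ.le t _ hF
    rw [trim_measurableSet_eq _ hF, trim_measurableSet_eq _ hF, withDensity_apply _ hF',
      Measure.smul_apply, Measure.restrict_restrict hF', Measure.restrict_apply hF', smul_eq_mul]
    have hmap : (P.restrict (F ∩ S)).map (X (t + 1)) = P (F ∩ S) • φ k := by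
      ext B hB
      rw [Measure.map_apply hX hB, Measure.restrict_apply (hX hB), Measure.smul_apply, smul_eq_mul]
      exact h.measure_inter_preimage t k (hF.inter hS) Set.inter_subset_right hB
    rw [← lintegral_map hf hX, hmap, lintegral_smul_measure, smul_eq_mul, mul_comm]
  have h1 := lintegral_trim (μ := Q.withDensity fun ω => f (X (t + 1) ω)) (ℱ.le t) hg
  rw [htrim, lintegral_trim (ℱ.le t) hg, lintegral_smul_measure, smul_eq_mul] at h1
  rw [h1, lintegral_withDensity_eq_lintegral_mul _ hfX (hg.mono (ℱ.le t) le_rfl)]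
  rfl

/-- The exponential martingale of one arm. -/
lemma lintegral_exp_eq_one [IsProbabilityMeasure P] (h : IsInteraction P φ ℱ A X)
    [∀ k, IsProbabilityMeasure (φ k)]
    (k : Fin K) {η ψ : ℝ} (hη : ∫⁻ x, ENNReal.ofReal (Real.exp (η * x - ψ)) ∂(φ k) = 1) (t : ℕ) :
    ∫⁻ ω, ENNReal.ofReal (Real.exp (η * armSum (fun s => A s ω) (fun s => X s ω) k t
      - pulls (fun s => A s ω) k t * ψ)) ∂P = 1 := by
  induction t with
  | zero => simp [pulls_zero, armSum_zero]
  | succ t ih =>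
    set W : Ω → ℝ≥0∞ := fun ω => ENNReal.ofReal
      (Real.exp (η * armSum (fun s => A s ω) (fun s => X s ω) k t
      - pulls (fun s => A s ω) k t * ψ)) with hW
    have hWm : Measurable[ℱ t] W := by
      have h1 := h.measurable_armSum k t
      have h2 : Measurable[ℱ t] fun ω => (pulls (fun s => A s ω) k t : ℝ) :=
        measurable_from_nat.comp (h.measurable_pulls k t)
      exact ENNReal.measurable_ofReal.comp
        (Real.measurable_exp.comp ((h1.const_mul η).sub (h2.mul_const ψ)))
    have hS : MeasurableSet {ω | A (t + 1) ω = k} := ℱ.le t _ (h.measurableSet_action t k)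
    rw [← ih, ← lintegral_add_compl _ hS, ← lintegral_add_compl W hS]
    congr 1
    · have h1 := h.setLIntegral_mul t k hWm
        (f := fun x => ENNReal.ofReal (Real.exp (η * x - ψ))) (by fun_prop)
      rw [hη, one_mul] at h1
      rw [← h1]
      refine setLIntegral_congr_fun hS fun ω hω => ?_
      have hω' : A (t + 1) ω = k := hω
      simp only [hW]
      rw [← ENNReal.ofReal_mul (Real.exp_pos _).le, ← Real.exp_add, pulls_succ, armSum_succ,
        if_pos hω', if_pos hω']
      congr 2
      push_cast
      ring
    · refine setLIntegral_congr_fun hS.compl fun ω hω => ?_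
      have hω' : ¬ A (t + 1) ω = k := hω
      simp only [hW]
      rw [pulls_succ, armSum_succ, if_neg hω', if_neg hω', add_zero, add_zero]

end IsInteraction

/-- A bound for the tails of a function at the points of a set bounds the measure of the preimage of
the set. -/
lemma measure_inter_mem_le {Ω : Type*} {mΩ : MeasurableSpace Ω} {P : Measure Ω} {F : Set Ω}
    {f : Ω → ℝ} {U : Set ℝ} (hU : BddBelow U) {c : ℝ≥0∞}
    (h : ∀ p ∈ U, P (F ∩ {ω | p ≤ f ω}) ≤ c) : P (F ∩ {ω | f ω ∈ U}) ≤ c := by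
  rcases U.eq_empty_or_nonempty with rfl | hne
  · simp
  by_cases hmem : sInf U ∈ U
  · exact (measure_mono fun ω hω => by
      exact ⟨hω.1, csInf_le hU hω.2⟩ : _ ≤ P (F ∩ {ω | sInf U ≤ f ω})).trans (h _ hmem)
  obtain ⟨u, hu, hlim, huU⟩ := exists_seq_tendsto_sInf hne hU
  have hsub : F ∩ {ω | f ω ∈ U} ⊆ ⋃ n, F ∩ {ω | u n ≤ f ω} := by
    intro ω hω
    have hlt : sInf U < f ω := lt_of_le_of_ne (csInf_le hU hω.2) fun he => hmem (he ▸ hω.2)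
    obtain ⟨n, hn⟩ := (hlim.eventually_lt_const hlt).exists
    exact Set.mem_iUnion.2 ⟨n, hω.1, hn.le⟩
  refine (measure_mono hsub).trans ?_
  rw [Monotone.measure_iUnion]
  · exact iSup_le fun n => h _ (huU n)
  · intro m n hmn ω hω
    exact ⟨hω.1, (hu hmn).trans hω.2⟩

/-! ### Chernoff bounds for the confidence region. -/

section Concentration

variable {Ω : Type*} {mΩ : MeasurableSpace Ω} {P : Measure Ω} [IsProbabilityMeasure P] {K : ℕ}
  {E : ExpFamily} {μ : Fin K → ℝ} {ℱ : Filtration ℕ mΩ} {A : ℕ → Ω → Fin K} {X : ℕ → Ω → ℝ}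

lemma ExpFamily.lintegral_exp_law (E : ExpFamily) {q θ : ℝ} (hq : q ∈ E.Θ)
    (hθ : θ ∈ integrableExpSet id E.base) :
    ∫⁻ x, ENNReal.ofReal (Real.exp ((θ - E.ν q) * x
      - (cgf id E.base θ - cgf id E.base (E.ν q)))) ∂(E.law q) = 1 := by
  simp_rw [Real.exp_sub _ (cgf id E.base θ - cgf id E.base (E.ν q))]
  rw [← ofReal_integral_eq_lintegral_ofReal ((E.integrable_exp_law hq hθ).div_const _)
    (ae_of_all _ fun x => by positivity), integral_div, E.integral_exp_law hq hθ,
    div_self (Real.exp_pos _).ne', ENNReal.ofReal_one]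

/-- Chernoff's bound for a fixed tilt and a fixed number of observations. -/
lemma measure_legendre_ge_le (hμ : ∀ k, μ k ∈ E.Θ)
    (h : IsInteraction P (fun k => E.law (μ k)) ℱ A X) (k : Fin K) {θ : ℝ}
    (hθ : θ ∈ integrableExpSet id E.base) {n : ℕ} (hn : n ≠ 0) (y : ℝ) (t : ℕ) :
    P ({ω | pulls (fun s => A s ω) k t = n} ∩
      {ω | y ≤ E.legendre θ (empMean (fun s => A s ω) (fun s => X s ω) t k) (μ k)})
      ≤ ENNReal.ofReal (Real.exp (-(n * y))) := by
  have hpr : ∀ k, IsProbabilityMeasure (E.law (μ k)) := fun k => E.isProbabilityMeasure_law (hμ k)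
  have hone := h.lintegral_exp_eq_one k (E.lintegral_exp_law (hμ k) hθ) t
  set ψ := cgf id E.base θ - cgf id E.base (E.ν (μ k)) with hψ
  set W : Ω → ℝ≥0∞ := fun ω => ENNReal.ofReal
      (Real.exp ((θ - E.ν (μ k)) * armSum (fun s => A s ω) (fun s => X s ω) k t
      - pulls (fun s => A s ω) k t * ψ)) with hW
  have hWm : AEMeasurable W P := by
    have h1 := (h.measurable_armSum k t).mono (ℱ.le t) le_rfl
    have h2 : Measurable fun ω => (pulls (fun s => A s ω) k t : ℝ) :=
      measurable_from_nat.comp ((h.measurable_pulls k t).mono (ℱ.le t) le_rfl)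
    exact (ENNReal.measurable_ofReal.comp
      (Real.measurable_exp.comp ((h1.const_mul _).sub (h2.mul_const ψ)))).aemeasurable
  have hmarkov := meas_ge_le_lintegral_div hWm (ε := ENNReal.ofReal (Real.exp (n * y)))
    (by simp [Real.exp_pos]) ENNReal.ofReal_ne_top
  rw [hone, one_div, ← ENNReal.ofReal_inv_of_pos (Real.exp_pos _), ← Real.exp_neg] at hmarkov
  refine (measure_mono fun ω hω => ?_).trans hmarkov
  obtain ⟨h1, h2⟩ := hω
  simp only [Set.mem_ofPred_eq] at h1 h2
  refine ENNReal.ofReal_le_ofReal (Real.exp_le_exp.2 ?_)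
  have hn' : (0 : ℝ) < n := by positivity
  have hS : armSum (fun s => A s ω) (fun s => X s ω) k t
      = n * empMean (fun s => A s ω) (fun s => X s ω) t k := by
    rw [empMean, h1]
    exact (mul_div_cancel₀ _ hn'.ne').symm
  rw [hS, h1]
  have := mul_le_mul_of_nonneg_left h2 hn'.le
  simp only [ExpFamily.legendre] at this
  linarith

/-- The divergence of the empirical mean after a fixed number of observations. -/
lemma measure_pulls_eq_lt_d_le (hμ : ∀ k, μ k ∈ E.Θ)
    (h : IsInteraction P (fun k => E.law (μ k)) ℱ A X) (k : Fin K) {n : ℕ} (hn : n ≠ 0)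
    {y : ℝ} (hy : 0 ≤ y) (t : ℕ) :
    P ({ω | pulls (fun s => A s ω) k t = n} ∩
      {ω | ENNReal.ofReal y < E.d (empMean (fun s => A s ω) (fun s => X s ω) t k) (μ k)})
      ≤ 2 * ENNReal.ofReal (Real.exp (-(n * y))) := by
  set F := {ω | pulls (fun s => A s ω) k t = n}
  set f : Ω → ℝ := fun ω => empMean (fun s => A s ω) (fun s => X s ω) t k
  set q := μ k
  have hle : ∀ θ ∈ integrableExpSet id E.base, (θ - E.ν q) * q
      ≤ cgf id E.base θ - cgf id E.base (E.ν q) := fun θ hθ => E.mul_le_cgf_sub (hμ k) hθ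
  -- For p > q a tilt θ witnessing d(p, q) > y must satisfy θ ≥ ν q, since otherwise the tangent
  -- inequality makes the functional negative. The functional is then monotone in the mean, so this
  -- one tilt controls all of {f ≥ p}.
  have hup : P (F ∩ {ω | f ω ∈ {p | q < p ∧ ENNReal.ofReal y < E.d p q}})
      ≤ ENNReal.ofReal (Real.exp (-(n * y))) := by
    refine measure_inter_mem_le ⟨q, fun p hp => hp.1.le⟩ fun p ⟨hqp, hp⟩ => ?_
    obtain ⟨θ, hθ, hlt⟩ := E.exists_lt_legendre (hμ k) hp
    have hlt' := ((ENNReal.ofReal_lt_ofReal_iff_of_nonneg hy).1 hlt).le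
    refine (measure_mono ?_).trans (measure_legendre_ge_le hμ h k hθ hn y t)
    intro ω ⟨hω, hω'⟩
    refine ⟨hω, hlt'.trans ?_⟩
    have hω' : p ≤ f ω := hω'
    have hpos : 0 ≤ θ - E.ν q := by
      by_contra! hc
      have := hle θ hθ
      have := mul_neg_of_neg_of_pos hc (sub_pos.2 hqp)
      simp only [ExpFamily.legendre] at hlt'
      linarith
    have := mul_le_mul_of_nonneg_left hω' hpos
    simp only [ExpFamily.legendre]
    linarith
  have hdown : P (F ∩ {ω | -f ω ∈ {p | -p < q ∧ ENNReal.ofReal y < E.d (-p) q}})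
      ≤ ENNReal.ofReal (Real.exp (-(n * y))) := by
    refine measure_inter_mem_le ⟨-q, fun p hp => by linarith [hp.1]⟩ fun p ⟨hqp, hp⟩ => ?_
    obtain ⟨θ, hθ, hlt⟩ := E.exists_lt_legendre (hμ k) hp
    have hlt' := ((ENNReal.ofReal_lt_ofReal_iff_of_nonneg hy).1 hlt).le
    refine (measure_mono ?_).trans (measure_legendre_ge_le hμ h k hθ hn y t)
    intro ω ⟨hω, hω'⟩
    refine ⟨hω, hlt'.trans ?_⟩
    have hω' : p ≤ -f ω := hω'
    have hneg : θ - E.ν q ≤ 0 := by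
      by_contra! hc
      have := hle θ hθ
      have := mul_pos hc (sub_pos.2 hqp)
      simp only [ExpFamily.legendre] at hlt'
      linarith
    have := mul_le_mul_of_nonpos_left hω' hneg
    simp only [ExpFamily.legendre]
    linarith
  rw [two_mul]
  refine (measure_mono ?_).trans ((measure_union_le _ _).trans (add_le_add hup hdown))
  intro ω ⟨hω, hω'⟩
  have hω' : ENNReal.ofReal y < E.d (f ω) q := hω'
  rcases lt_trichotomy q (f ω) with hlt | heq | hlt
  · exact Or.inl ⟨hω, hlt, hω'⟩
  · rw [← heq, E.d_self (hμ k)] at hω'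
    exact absurd hω' not_lt_zero
  · exact Or.inr ⟨hω, by simpa using hlt, by simpa using hω'⟩

/-- The pull count is random, so a union bound over its values 1, …, t is taken; a count of zero
makes the product vanish. -/
lemma measure_lt_pulls_mul_d_le (hμ : ∀ k, μ k ∈ E.Θ)
    (h : IsInteraction P (fun k => E.law (μ k)) ℱ A X) (k : Fin K)
    {x : ℝ} (hx : 0 ≤ x) (t : ℕ) :
    P {ω | ENNReal.ofReal x < (pulls (fun s => A s ω) k t : ℝ≥0∞) *
      E.d (empMean (fun s => A s ω) (fun s => X s ω) t k) (μ k)}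
      ≤ t * (2 * ENNReal.ofReal (Real.exp (-x))) := by
  have hsub : {ω | ENNReal.ofReal x < (pulls (fun s => A s ω) k t : ℝ≥0∞) *
      E.d (empMean (fun s => A s ω) (fun s => X s ω) t k) (μ k)} ⊆
      ⋃ n ∈ Finset.Icc 1 t, ({ω | pulls (fun s => A s ω) k t = n} ∩ {ω | ENNReal.ofReal (x / n)
        < E.d (empMean (fun s => A s ω) (fun s => X s ω) t k) (μ k)}) := by
    intro ω hω
    simp only [Set.mem_ofPred_eq] at hω
    have hn : pulls (fun s => A s ω) k t ≠ 0 := by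
      intro h0
      rw [h0] at hω
      simp at hω
    refine Set.mem_biUnion
      (Finset.mem_Icc.2 ⟨Nat.one_le_iff_ne_zero.2 hn, pulls_le _ k t⟩) ⟨rfl, ?_⟩
    simp only [Set.mem_ofPred_eq]
    rw [ENNReal.ofReal_div_of_pos (by positivity), ENNReal.ofReal_natCast]
    exact ENNReal.div_lt_of_lt_mul' hω
  refine (measure_mono hsub).trans ((measure_biUnion_finset_le _ _).trans ?_)
  calc _ ≤ ∑ n ∈ Finset.Icc 1 t, 2 * ENNReal.ofReal (Real.exp (-x)) := by
        refine Finset.sum_le_sum fun n hn => ?_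
        have hn0 : n ≠ 0 := by have := (Finset.mem_Icc.1 hn).1; omega
        have h1 := measure_pulls_eq_lt_d_le hμ h k hn0 (y := x / n) (by positivity) t
        rwa [mul_div_cancel₀ _ (by positivity : (n : ℝ) ≠ 0)] at h1
    _ = _ := by simp

/-- The true model leaves the confidence region with small probability. -/
lemma measure_not_sum_le (hμ : ∀ k, μ k ∈ E.Θ)
    (h : IsInteraction P (fun k => E.law (μ k)) ℱ A X) {DK : ℝ} (hDK : 6 * K ≤ DK) (hK : 1 ≤ K)
    {t : ℕ} (ht : 2 * K ≤ t) :
    P {ω | ¬ ∑ k, (pulls (fun s => A s ω) k t : ℝ≥0∞) *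
      E.d (empMean (fun s => A s ω) (fun s => X s ω) t k) (μ k) ≤ ENNReal.ofReal (DK * Real.log t)}
      ≤ ENNReal.ofReal (1 / (t : ℝ) ^ 4) := by
  have hK0 : (0 : ℝ) < K := by positivity
  have ht1 : (1 : ℝ) ≤ t := by exact_mod_cast (by omega : 1 ≤ t)
  have hlog : 0 ≤ Real.log t := Real.log_nonneg ht1
  -- The confidence budget is split equally among the arms. Each share is at least 6 log t, and t⁻⁶
  -- absorbs the factor 2Kt ≤ t² from the two sides, the arms and the counts.
  set x := DK * Real.log t / K with hx
  have hx6 : 6 * Real.log t ≤ x := by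
    rw [hx, le_div_iff₀ hK0]
    nlinarith
  have hx0 : 0 ≤ x := by linarith
  have hsub : {ω | ¬ ∑ k, (pulls (fun s => A s ω) k t : ℝ≥0∞) *
      E.d (empMean (fun s => A s ω) (fun s => X s ω) t k) (μ k) ≤ ENNReal.ofReal (DK * Real.log t)}
      ⊆ ⋃ k ∈ Finset.univ, {ω | ENNReal.ofReal x < (pulls (fun s => A s ω) k t : ℝ≥0∞) *
      E.d (empMean (fun s => A s ω) (fun s => X s ω) t k) (μ k)} := by
    intro ω hω
    by_contra hc
    simp only [Finset.mem_univ, Set.iUnion_true, Set.mem_iUnion, Set.mem_ofPred_eq, not_exists,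
      not_lt] at hc
    refine hω ((Finset.sum_le_sum fun k _ => hc k).trans ?_)
    rw [Finset.sum_const, Finset.card_univ, Fintype.card_fin, nsmul_eq_mul,
      ← ENNReal.ofReal_natCast, ← ENNReal.ofReal_mul hK0.le, hx, mul_div_cancel₀ _ hK0.ne']
  refine (measure_mono hsub).trans ((measure_biUnion_finset_le _ _).trans ?_)
  calc _ ≤ ∑ k : Fin K, (t * (2 * ENNReal.ofReal (Real.exp (-x)))) :=
        Finset.sum_le_sum fun k _ => measure_lt_pulls_mul_d_le hμ h k hx0 t
    _ = ENNReal.ofReal (2 * K * t * Real.exp (-x)) := by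
        rw [Finset.sum_const, Finset.card_univ, Fintype.card_fin, nsmul_eq_mul,
          ENNReal.ofReal_mul (by positivity), ENNReal.ofReal_mul (by positivity),
          ENNReal.ofReal_mul (by positivity)]
        simp only [ENNReal.ofReal_natCast, ENNReal.ofReal_ofNat]
        ring
    _ ≤ _ := by
        refine ENNReal.ofReal_le_ofReal ?_
        have hexp : Real.exp (-x) ≤ 1 / (t : ℝ) ^ 6 := by
          calc Real.exp (-x) ≤ Real.exp (-(6 * Real.log t)) := Real.exp_le_exp.2 (by linarith)
            _ = 1 / (t : ℝ) ^ 6 := by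
              rw [Real.exp_neg, one_div, mul_comm, Real.exp_mul, Real.exp_log (by linarith)]
              norm_cast
        have h2K : (2 * K : ℝ) ≤ t := by exact_mod_cast ht
        calc 2 * K * t * Real.exp (-x) ≤ t * t * (1 / (t : ℝ) ^ 6) := by gcongr
          _ = 1 / (t : ℝ) ^ 4 := by field_simp

end Concentration

/-! ### C-Tracking and forced exploration. -/

section Tracking

variable {K : ℕ}

/-- Every weight vector is close to the truncated simplex. -/
lemma IsSupProj.abs_sub_le {ε : ℝ} (hε : 0 ≤ ε) (hKε : K * ε ≤ 1) {w v : Fin K → ℝ}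
    (hw : w ∈ stdSimplex ℝ (Fin K)) (h : IsSupProj (truncSimplex K ε) w v) (k : Fin K) :
    |w k - v k| ≤ K * ε := by
  have hK : (1 : ℝ) ≤ K := by exact_mod_cast (Fin.pos k)
  have hw1 : ∀ k, w k ≤ 1 := fun k => by
    rw [← hw.2]
    exact Finset.single_le_sum (fun j _ => hw.1 j) (Finset.mem_univ k)
  have hKε0 : 0 ≤ K * ε := by positivity
  -- Mixing w with the uniform distribution gives a competitor at sup distance at most Kε.
  have hu : (fun k => (1 - K * ε) * w k + ε) ∈ truncSimplex K ε := by
    refine ⟨⟨fun k => ?_, ?_⟩, fun k => ⟨?_, ?_⟩⟩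
    · have := mul_nonneg (sub_nonneg.2 hKε) (hw.1 k)
      linarith
    · rw [Finset.sum_add_distrib, ← Finset.mul_sum, hw.2]
      simp
    · have := mul_nonneg (sub_nonneg.2 hKε) (hw.1 k)
      linarith
    · have := mul_le_mul_of_nonneg_left (hw1 k) (sub_nonneg.2 hKε)
      nlinarith
  have hd := h.2 _ hu
  have h1 : |w k - v k| ≤ dist w v := by
    rw [← Real.dist_eq]; exact dist_le_pi_dist w v k
  refine h1.trans (hd.trans ((dist_pi_le_iff hKε0).2 fun j => ?_))
  rw [Real.dist_eq, abs_le]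
  have := mul_le_mul_of_nonneg_left (hw1 j) hKε0
  have := mul_nonneg hKε0 (hw.1 j)
  constructor <;> nlinarith

lemma explore_nonneg (K t : ℕ) : 0 ≤ explore K t := by unfold explore; positivity

lemma mul_explore_le_one (K t : ℕ) : K * explore K t ≤ 1 := by
  rcases K.eq_zero_or_pos with rfl | hK
  · simp
  have hK' : (0 : ℝ) < K := by positivity
  have h1 : (K : ℝ) ≤ √((K : ℝ) ^ 2 + t) :=
    Real.le_sqrt_of_sq_le (by linarith [t.cast_nonneg (α := ℝ)])
  have h2 : (√((K : ℝ) ^ 2 + t))⁻¹ ≤ (K : ℝ)⁻¹ := inv_anti₀ hK' h1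
  unfold explore
  have := mul_le_mul_of_nonneg_left h2 hK'.le
  rw [mul_inv_cancel₀ hK'.ne'] at this
  linarith

/-- `explore K t` is the derivative at t of the concave function t ↦ √(K² + t), so sums of it
telescope from below; `explore_le_sqrt_succ_sub` is the matching upper comparison, with √t. -/
lemma sqrt_succ_sub_le_explore (hK : 1 ≤ K) (t : ℕ) :
    √((K : ℝ) ^ 2 + (t + 1 : ℕ)) - √((K : ℝ) ^ 2 + t) ≤ explore K t := by
  have hpos : (0 : ℝ) < (K : ℝ) ^ 2 + t := by positivity
  have hs := Real.sqrt_pos.2 hpos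
  have h1 := Real.sq_sqrt hpos.le
  have h2 : √((K : ℝ) ^ 2 + (t + 1 : ℕ)) ≤ √((K : ℝ) ^ 2 + t) + explore K t := by
    refine Real.sqrt_le_iff.2 ⟨by have := explore_nonneg K t; positivity, ?_⟩
    have : 2 * √((K : ℝ) ^ 2 + t) * explore K t = 1 := by unfold explore; field_simp
    push_cast
    nlinarith [sq_nonneg (explore K t)]
  linarith

lemma sqrt_add_inv_sqrt_succ_le (t : ℕ) :
    √(t : ℝ) + (√((t + 1 : ℕ) : ℝ))⁻¹ / 2 ≤ √((t + 1 : ℕ) : ℝ) := by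
  have hpos : (0 : ℝ) < ((t + 1 : ℕ) : ℝ) := by positivity
  have hs := Real.sqrt_pos.2 hpos
  set r := √((t + 1 : ℕ) : ℝ)
  have hr : r ^ 2 = (t + 1 : ℕ) := Real.sq_sqrt hpos.le
  have hr1 : 1 ≤ r := by
    have : (1 : ℝ) ≤ r ^ 2 := by rw [hr]; push_cast; linarith [t.cast_nonneg (α := ℝ)]
    nlinarith
  have hi : r⁻¹ ≤ 1 := inv_le_one_of_one_le₀ hr1
  have hri : r * r⁻¹ = 1 := mul_inv_cancel₀ hs.ne'
  have h2 : √(t : ℝ) ≤ r - r⁻¹ / 2 := by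
    refine Real.sqrt_le_iff.2 ⟨by linarith, ?_⟩
    have : (t : ℝ) = r ^ 2 - 1 := by rw [hr]; push_cast; ring
    nlinarith [sq_nonneg r⁻¹]
  linarith

lemma explore_le_sqrt_succ_sub (hK : 1 ≤ K) (t : ℕ) :
    explore K t ≤ √((t + 1 : ℕ) : ℝ) - √(t : ℝ) := by
  have hpos : (0 : ℝ) < ((t + 1 : ℕ) : ℝ) := by positivity
  have hs := Real.sqrt_pos.2 hpos
  have hK1 : (1 : ℝ) ≤ (K : ℝ) ^ 2 := one_le_pow₀ (by exact_mod_cast hK)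
  have h0 : explore K t ≤ (√((t + 1 : ℕ) : ℝ))⁻¹ / 2 := by
    unfold explore
    gcongr
    push_cast
    linarith
  linarith [sqrt_add_inv_sqrt_succ_le t]

lemma sqrt_sub_le_sum_explore (hK : 1 ≤ K) {t : ℕ} (ht : K ≤ t) :
    √((K : ℝ) ^ 2 + t) - √((K : ℝ) ^ 2 + K) ≤ ∑ r ∈ Finset.Ico K t, explore K r := by
  rw [← Finset.sum_Ico_sub (fun r : ℕ => √((K : ℝ) ^ 2 + r)) ht]
  exact Finset.sum_le_sum fun r _ => sqrt_succ_sub_le_explore hK r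

lemma sum_explore_le (hK : 1 ≤ K) {t : ℕ} (ht : K ≤ t) :
    ∑ r ∈ Finset.Ico K t, explore K r ≤ √(t : ℝ) := by
  have h := Finset.sum_Ico_sub (fun r : ℕ => √(r : ℝ)) ht
  have h2 : ∑ r ∈ Finset.Ico K t, explore K r ≤ √(t : ℝ) - √(K : ℝ) := by
    rw [← h]
    exact Finset.sum_le_sum fun r _ => explore_le_sqrt_succ_sub hK r
  linarith [Real.sqrt_nonneg (K : ℝ)]

variable {a : ℕ → Fin K} {v : ℕ → Fin K → ℝ}

/-- The conditions of C-Tracking with target weights `v`. -/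
structure IsCTracking (a : ℕ → Fin K) (v : ℕ → Fin K → ℝ) : Prop where
  init : ∀ k, pulls a k K = 1
  mem : ∀ t, K ≤ t → v t ∈ stdSimplex ℝ (Fin K)
  argmax : ∀ t, K ≤ t → ∀ k, ∑ s ∈ Finset.Icc K t, v s k - (pulls a k t : ℝ)
      ≤ ∑ s ∈ Finset.Icc K t, v s (a (t + 1)) - (pulls a (a (t + 1)) t : ℝ)

namespace IsCTracking

lemma sum_weights (h : IsCTracking a v) {t : ℕ} (ht : K ≤ t) :
    ∑ k, ∑ s ∈ Finset.Ico K t, v s k = (t : ℝ) - K := by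
  rw [Finset.sum_comm, Finset.sum_congr rfl fun s hs => (h.mem s (Finset.mem_Ico.1 hs).1).2]
  simp [Nat.cast_sub ht]

lemma sum_pulls_cast (a : ℕ → Fin K) (t : ℕ) : ∑ k, (pulls a k t : ℝ) = t := by
  exact_mod_cast sum_pulls a t

/-- The deficits maximized by C-Tracking sum to (t + 1 - K) - t = 1 - K, so the pulled arm has
deficit at least (1 - K)/K > -1. A pull can therefore overshoot the target by less than 2. -/
lemma pulls_le_add (h : IsCTracking a v) {t : ℕ} (ht : K ≤ t) (k : Fin K) :
    (pulls a k t : ℝ) ≤ ∑ s ∈ Finset.Ico K t, v s k + 2 := by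
  have hK : (1 : ℝ) ≤ K := by exact_mod_cast (Fin.pos k)
  induction t, ht using Nat.le_induction with
  | base => simp [h.init]
  | succ t ht ih =>
    rw [pulls_succ]
    by_cases hk : a (t + 1) = k
    · rw [if_pos hk]
      have hsum : ∑ j, (∑ s ∈ Finset.Ico K (t + 1), v s j - (pulls a j t : ℝ))
          ≤ ∑ _j : Fin K, (∑ s ∈ Finset.Ico K (t + 1), v s k - (pulls a k t : ℝ)) := by
        refine Finset.sum_le_sum fun j _ => ?_
        have := h.argmax t ht j
        rwa [hk] at this
      rw [Finset.sum_sub_distrib, h.sum_weights (by omega), sum_pulls_cast, Finset.sum_const,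
        Finset.card_univ, Fintype.card_fin, nsmul_eq_mul] at hsum
      push_cast at hsum ⊢
      by_contra! hc
      nlinarith
    · rw [if_neg hk, add_zero, Finset.sum_Ico_succ_top ht]
      have := (h.mem t ht).1 k
      linarith

/-- What the other K - 1 arms do not use, each overshooting by at most 2, is left for arm k. -/
lemma le_pulls (h : IsCTracking a v) {t : ℕ} (ht : K ≤ t) (k : Fin K) :
    ∑ s ∈ Finset.Ico K t, v s k - K + 2 ≤ (pulls a k t : ℝ) := by
  have h1 : ∑ j ∈ Finset.univ.erase k, (pulls a j t : ℝ)
      ≤ ∑ j ∈ Finset.univ.erase k, (∑ s ∈ Finset.Ico K t, v s j + 2) :=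
    Finset.sum_le_sum fun j _ => h.pulls_le_add ht j
  rw [Finset.sum_add_distrib, Finset.sum_const, Finset.card_erase_of_mem (Finset.mem_univ k),
    Finset.card_univ, Fintype.card_fin, nsmul_eq_mul, Nat.cast_sub (Fin.pos k)] at h1
  have h2 := Finset.add_sum_erase Finset.univ (fun j => (pulls a j t : ℝ)) (Finset.mem_univ k)
  have h3 := Finset.add_sum_erase Finset.univ (fun j => ∑ s ∈ Finset.Ico K t, v s j)
    (Finset.mem_univ k)
  rw [sum_pulls_cast] at h2
  rw [h.sum_weights ht] at h3
  push_cast at h1 h2 h3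
  linarith

/-- Forced exploration. -/
lemma sqrt_sub_le_pulls (h : IsCTracking a v) (hv : ∀ t, K ≤ t → ∀ k, explore K t ≤ v t k)
    {t : ℕ} (ht : K ≤ t) (k : Fin K) :
    √((t : ℝ) + (K : ℝ) ^ 2) - 2 * K ≤ (pulls a k t : ℝ) := by
  have hK : 1 ≤ K := Fin.pos k
  have hK' : (1 : ℝ) ≤ K := by exact_mod_cast hK
  have h1 := h.le_pulls ht k
  have h2 := sqrt_sub_le_sum_explore hK ht
  have h3 : ∑ r ∈ Finset.Ico K t, explore K r ≤ ∑ s ∈ Finset.Ico K t, v s k :=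
    Finset.sum_le_sum fun s hs => hv s (Finset.mem_Ico.1 hs).1 k
  have h4 : √((K : ℝ) ^ 2 + K) ≤ K + 1 :=
    Real.sqrt_le_iff.2 ⟨by linarith, by nlinarith⟩
  rw [add_comm (t : ℝ)]
  linarith

/-- The numbers of pulls follow the weights whose projections are tracked. -/
lemma sum_sub_le_pulls (h : IsCTracking a v) {w : ℕ → Fin K → ℝ}
    (hw : ∀ t, K ≤ t → ∀ k, |w t k - v t k| ≤ K * explore K t) {t : ℕ} (ht : K ≤ t) (k : Fin K) :
    ∑ s ∈ Finset.Ico K t, w s k - K * (√(t : ℝ) + 1) ≤ (pulls a k t : ℝ) := by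
  have hK : 1 ≤ K := Fin.pos k
  have h1 := h.le_pulls ht k
  have h2 : ∑ s ∈ Finset.Ico K t, w s k
      ≤ ∑ s ∈ Finset.Ico K t, v s k + K * ∑ r ∈ Finset.Ico K t, explore K r := by
    rw [Finset.mul_sum, ← Finset.sum_add_distrib]
    refine Finset.sum_le_sum fun s hs => ?_
    have := (abs_le.1 (hw s (Finset.mem_Ico.1 hs).1 k)).2
    linarith
  have h3 := mul_le_mul_of_nonneg_left (sum_explore_le hK ht) (Nat.cast_nonneg (α := ℝ) K)
  linarith

end IsCTracking

end Tracking

/-! ### Elementary estimates -/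

lemma sqrt_sub_pos_and_le {K s : ℕ} (hK : 1 ≤ K) (hs : 10 * K ^ 4 ≤ s) :
    √(s : ℝ) / 4 ≤ √((s : ℝ) + (K : ℝ) ^ 2) - 2 * K ∧ 3 * (K : ℝ) ^ 2 ≤ √(s : ℝ) := by
  have hK' : (1 : ℝ) ≤ K := by exact_mod_cast hK
  have hs' : 10 * (K : ℝ) ^ 4 ≤ s := by exact_mod_cast hs
  have h1 : 3 * (K : ℝ) ^ 2 ≤ √(s : ℝ) :=
    Real.le_sqrt_of_sq_le (by nlinarith [pow_nonneg (by linarith : (0 : ℝ) ≤ K) 4])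
  have h2 : √(s : ℝ) ≤ √((s : ℝ) + (K : ℝ) ^ 2) := Real.sqrt_le_sqrt (by nlinarith)
  exact ⟨by nlinarith, h1⟩

/-- Forced exploration outweighs the logarithmic confidence level. -/
lemma log_mul_le_log_mul {κ u w : ℝ} (hκ : 1 ≤ κ) (hu : 2 * κ < u) (huw : u ≤ w) :
    Real.log (w ^ 2 - κ ^ 2) * (u - 2 * κ) ≤ Real.log (u ^ 2 - κ ^ 2) * (w - 2 * κ) := by
  have h1 : 0 < u - κ := by linarith
  have h2 : 0 < u + κ := by linarith
  have h3 : 0 < w - κ := by linarith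
  have h4 : 0 < w + κ := by linarith
  have hx : 0 < u ^ 2 - κ ^ 2 := by nlinarith
  have key : ∀ x y : ℝ, 0 < x → 0 < y → Real.log y ≤ Real.log x + (y - x) / x := by
    intro x y hx hy
    have := Real.log_le_sub_one_of_pos (div_pos hy hx)
    rw [Real.log_div hy.ne' hx.ne'] at this
    rw [sub_div, div_self hx.ne']
    linarith
  have e1 : Real.log (w ^ 2 - κ ^ 2) = Real.log (w - κ) + Real.log (w + κ) := by
    rw [← Real.log_mul h3.ne' h4.ne']; ring_nf
  have e2 : Real.log (u ^ 2 - κ ^ 2) = Real.log (u - κ) + Real.log (u + κ) := by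
    rw [← Real.log_mul h1.ne' h2.ne']; ring_nf
  have hc : Real.log (w ^ 2 - κ ^ 2)
      ≤ Real.log (u ^ 2 - κ ^ 2) + (w - u) * (2 * u / (u ^ 2 - κ ^ 2)) := by
    have k1 := key (u - κ) (w - κ) h1 h3
    have k2 := key (u + κ) (w + κ) h2 h4
    have : (w - κ - (u - κ)) / (u - κ) + (w + κ - (u + κ)) / (u + κ)
        = (w - u) * (2 * u / (u ^ 2 - κ ^ 2)) := by
      rw [show u ^ 2 - κ ^ 2 = (u - κ) * (u + κ) by ring]
      field_simp
      ring
    rw [e1, e2]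
    linarith
  -- The tangent bound at x = u² - κ², compared with e², gives log x ≥ 3 - e²/x. What remains is e²
  -- ≤ u² + 4uκ - 3κ², whose right side exceeds 9κ² ≥ 9.
  have hlog : 2 * u / (u ^ 2 - κ ^ 2) * (u - 2 * κ) ≤ Real.log (u ^ 2 - κ ^ 2) := by
    have hexp : Real.exp 1 < 2.7182818286 := Real.exp_one_lt_d9
    have k := key (u ^ 2 - κ ^ 2) (Real.exp 1 ^ 2) hx (by positivity)
    rw [Real.log_pow, Real.log_exp] at k
    have hlt : Real.exp 1 ^ 2 < 7.4 := by
      have := Real.exp_pos 1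
      nlinarith
    have : (Real.exp 1 ^ 2 - (u ^ 2 - κ ^ 2)) / (u ^ 2 - κ ^ 2)
        + 2 * u / (u ^ 2 - κ ^ 2) * (u - 2 * κ) ≤ 2 := by
      rw [div_mul_eq_mul_div, ← add_div, div_le_iff₀ hx]
      nlinarith
    push_cast at k
    linarith
  have hw : 0 ≤ w - u := by linarith
  have hu' : 0 ≤ u - 2 * κ := by linarith
  have m1 := mul_le_mul_of_nonneg_right hc hu'
  have m2 := mul_le_mul_of_nonneg_left hlog hw
  nlinarith

/-- The rate at which the projected empirical means and the confidence region concentrate. -/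
noncomputable def confRadius (K : ℕ) (σ DK : ℝ) (s : ℕ) : ℝ :=
  √(2 * σ ^ 2 * DK * Real.log s / (√((s : ℝ) + (K : ℝ) ^ 2) - 2 * K))

lemma confRadius_nonneg (K : ℕ) (σ DK : ℝ) (s : ℕ) : 0 ≤ confRadius K σ DK s := Real.sqrt_nonneg _

/-- Needed because `sInf` of an empty set of naturals is 0. With n = m⁸ the denominator is of order
√√n = m², while log n ≤ 8m. -/
lemma exists_mem_Tmu {K : ℕ} (hK : 1 ≤ K) {σ DK ε : ℝ} (hDK : 0 ≤ DK) (hε : 0 < ε) :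
    {n : ℕ | 0 < √(√n + (K : ℝ) ^ 2) - 2 * K ∧
      √(8 * DK * σ ^ 2 * Real.log n / (√(√n + (K : ℝ) ^ 2) - 2 * K)) ≤ ε}.Nonempty := by
  have hK' : (1 : ℝ) ≤ K := by exact_mod_cast hK
  obtain ⟨m, hm⟩ := exists_nat_ge (max (4 * K : ℝ) (128 * DK * σ ^ 2 / ε ^ 2))
  have hm1 : 4 * (K : ℝ) ≤ m := (le_max_left _ _).trans hm
  have hm2 : 128 * DK * σ ^ 2 ≤ m * ε ^ 2 := by
    rw [← div_le_iff₀ (by positivity)]; exact (le_max_right _ _).trans hm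
  have hm0 : (0 : ℝ) < m := by linarith
  have e1 : √((m ^ 8 : ℕ) : ℝ) = (m : ℝ) ^ 4 := by
    rw [Nat.cast_pow, show (m : ℝ) ^ 8 = ((m : ℝ) ^ 4) ^ 2 by ring, Real.sqrt_sq (by positivity)]
  have hden : (m : ℝ) ^ 2 / 2 ≤ √(√((m ^ 8 : ℕ) : ℝ) + (K : ℝ) ^ 2) - 2 * K := by
    have : (m : ℝ) ^ 2 ≤ √(√((m ^ 8 : ℕ) : ℝ) + (K : ℝ) ^ 2) := by
      rw [e1]
      exact Real.le_sqrt_of_sq_le (by nlinarith)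
    nlinarith
  have hpos : 0 < √(√((m ^ 8 : ℕ) : ℝ) + (K : ℝ) ^ 2) - 2 * K := by
    have : 0 < (m : ℝ) ^ 2 / 2 := by positivity
    linarith
  refine ⟨m ^ 8, hpos, Real.sqrt_le_iff.2 ⟨hε.le, ?_⟩⟩
  rw [div_le_iff₀ hpos]
  have hlog : Real.log ((m ^ 8 : ℕ) : ℝ) ≤ 8 * m := by
    rw [Nat.cast_pow, Real.log_pow]
    have := Real.log_le_self hm0.le
    push_cast
    linarith
  calc 8 * DK * σ ^ 2 * Real.log ((m ^ 8 : ℕ) : ℝ) ≤ 8 * DK * σ ^ 2 * (8 * m) := by gcongr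
    _ ≤ ε ^ 2 * ((m : ℝ) ^ 2 / 2) := by nlinarith
    _ ≤ _ := by gcongr

/-- The condition in `Tmu` passes from the infimum n to all s ≥ n: with u = √(√n + K²) one has log n
= 2 log(u² - K²), and `log_mul_le_log_mul` says that log n / (u - 2K) is nonincreasing. Replacing √s
by s in the denominator only helps. -/
lemma two_mul_confRadius_le {K : ℕ} (hK : 1 ≤ K) {σ DK ε : ℝ} (hDK : 0 ≤ DK) (hε : 0 < ε) {s : ℕ}
    (hs : Tmu K σ DK ε ≤ s) : 2 * confRadius K σ DK s ≤ ε := by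
  have hK' : (1 : ℝ) ≤ K := by exact_mod_cast hK
  obtain ⟨hpos, hle⟩ := Nat.sInf_mem (exists_mem_Tmu hK (σ := σ) hDK hε)
  have hs1 : 10 * K ^ 4 ≤ s := (le_max_left _ _).trans hs
  have hs2 := (le_max_right _ _).trans hs
  set n := sInf {n : ℕ | 0 < √(√n + (K : ℝ) ^ 2) - 2 * K ∧
    √(8 * DK * σ ^ 2 * Real.log n / (√(√n + (K : ℝ) ^ 2) - 2 * K)) ≤ ε}
  obtain ⟨-, h3⟩ := sqrt_sub_pos_and_le hK hs1
  have hs0 : (1 : ℝ) ≤ s := by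
    exact_mod_cast (le_trans (by nlinarith [Nat.one_le_pow 4 K hK] : 1 ≤ 10 * K ^ 4) hs1)
  set u := √(√(n : ℝ) + (K : ℝ) ^ 2)
  set w := √(√(s : ℝ) + (K : ℝ) ^ 2)
  have huw : u ≤ w := Real.sqrt_le_sqrt (by
    have : √(n : ℝ) ≤ √(s : ℝ) := Real.sqrt_le_sqrt (by exact_mod_cast hs2)
    linarith)
  have hlog : ∀ m : ℕ, Real.log (√(√(m : ℝ) + (K : ℝ) ^ 2) ^ 2 - (K : ℝ) ^ 2)
      = Real.log m / 2 := by
    intro m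
    rw [Real.sq_sqrt (by positivity), add_sub_cancel_right, Real.log_sqrt (by positivity)]
  have hmono := log_mul_le_log_mul hK' (by linarith : 2 * (K : ℝ) < u) huw
  rw [hlog, hlog] at hmono
  have hwpos : 0 < w - 2 * K := by linarith
  have hle' := (Real.sqrt_le_left hε.le).1 hle
  have hlogs : 0 ≤ Real.log s := Real.log_nonneg hs0
  have hww : w ≤ √((s : ℝ) + (K : ℝ) ^ 2) := Real.sqrt_le_sqrt (by
    have : √(s : ℝ) ≤ s := Real.sqrt_le_iff.2 ⟨by linarith, by nlinarith⟩
    linarith)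
  have hr : (2 * confRadius K σ DK s) ^ 2 ≤ ε ^ 2 := by
    rw [mul_pow, confRadius, Real.sq_sqrt (div_nonneg (by positivity) (by linarith))]
    calc 2 ^ 2 * (2 * σ ^ 2 * DK * Real.log s / (√((s : ℝ) + (K : ℝ) ^ 2) - 2 * K))
        = 8 * DK * σ ^ 2 * (Real.log s / (√((s : ℝ) + (K : ℝ) ^ 2) - 2 * K)) := by ring
      _ ≤ 8 * DK * σ ^ 2 * (Real.log s / (w - 2 * K)) := by gcongr
      _ ≤ 8 * DK * σ ^ 2 * (Real.log n / (u - 2 * K)) := by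
          refine mul_le_mul_of_nonneg_left ?_ (by positivity)
          rw [div_le_div_iff₀ hwpos hpos]
          linarith
      _ = 8 * DK * σ ^ 2 * Real.log n / (u - 2 * K) := by ring
      _ ≤ ε ^ 2 := hle'
  exact le_of_sq_le_sq hr hε.le

lemma confRadius_sq_le {K : ℕ} (hK : 1 ≤ K) {σ DK : ℝ} (hDK : 0 ≤ DK) {s t : ℕ}
    (hs : 10 * K ^ 4 ≤ s) (hst : s ≤ t) :
    confRadius K σ DK s ^ 2 ≤ 8 * σ ^ 2 * DK * Real.log t / √(s : ℝ) := by
  obtain ⟨h1, h3⟩ := sqrt_sub_pos_and_le hK hs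
  have hK' : (1 : ℝ) ≤ K := by exact_mod_cast hK
  have hsq : 0 < √(s : ℝ) := by nlinarith
  have hs0 : (0 : ℝ) < s := Real.sqrt_pos.1 hsq
  have hs1 : (1 : ℝ) ≤ s := by exact_mod_cast (by exact_mod_cast hs0 : 0 < s)
  have hlogs : 0 ≤ Real.log s := Real.log_nonneg hs1
  have hlog : Real.log s ≤ Real.log t := Real.log_le_log hs0 (by exact_mod_cast hst)
  rw [confRadius, Real.sq_sqrt (div_nonneg (by positivity) (by linarith))]
  calc 2 * σ ^ 2 * DK * Real.log s / (√((s : ℝ) + (K : ℝ) ^ 2) - 2 * K)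
      ≤ 2 * σ ^ 2 * DK * Real.log t / (√(s : ℝ) / 4) := by gcongr
    _ = 8 * σ ^ 2 * DK * Real.log t / √(s : ℝ) := by field_simp; ring

lemma sum_inv_sqrt_le (t : ℕ) : ∑ s ∈ Finset.Ico 1 (t + 1), 1 / √(s : ℝ) ≤ 2 * √(t : ℝ) := by
  induction t with
  | zero => simp
  | succ t ih =>
    rw [Finset.sum_Ico_succ_top (by omega), one_div]
    linarith [sqrt_add_inv_sqrt_succ_le t]

/-- Cauchy-Schwarz: the squared radii are O(log t / √s) and sum to O(√t log t). This is the source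
of the order √(t^(3/2)). -/
lemma sum_confRadius_le {K : ℕ} (hK : 1 ≤ K) {σ DK : ℝ} (hσ : 0 ≤ σ) (hDK : 0 ≤ DK) {r t : ℕ}
    (hr : 10 * K ^ 4 ≤ r) (hrt : r ≤ t) :
    ∑ s ∈ Finset.Ico r t, confRadius K σ DK s
      ≤ 4 * σ * (√(Real.log t) * √(DK * (t * √(t : ℝ)))) := by
  have hr1 : 1 ≤ r := le_trans (by nlinarith [Nat.one_le_pow 4 K hK]) hr
  have ht1 : (1 : ℝ) ≤ t := by exact_mod_cast hr1.trans hrt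
  have hlog : 0 ≤ Real.log t := Real.log_nonneg ht1
  have h1 := sq_sum_le_card_mul_sum_sq (s := Finset.Ico r t) (f := fun s => confRadius K σ DK s)
  have h2 : ∑ s ∈ Finset.Ico r t, confRadius K σ DK s ^ 2
      ≤ 8 * σ ^ 2 * DK * Real.log t * (2 * √(t : ℝ)) := by
    calc _ ≤ ∑ s ∈ Finset.Ico r t, 8 * σ ^ 2 * DK * Real.log t * (1 / √(s : ℝ)) := by
          refine Finset.sum_le_sum fun s hs => ?_
          rw [mul_one_div]
          have hs := Finset.mem_Ico.1 hs
          exact confRadius_sq_le hK hDK (hr.trans hs.1) hs.2.le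
      _ = 8 * σ ^ 2 * DK * Real.log t * ∑ s ∈ Finset.Ico r t, 1 / √(s : ℝ) := by
          rw [Finset.mul_sum]
      _ ≤ _ := by
          refine mul_le_mul_of_nonneg_left ?_ (by positivity)
          refine le_trans ?_ (sum_inv_sqrt_le t)
          exact Finset.sum_le_sum_of_subset_of_nonneg (Finset.Ico_subset_Ico hr1 (by omega))
            fun _ _ _ => by positivity
  have hcard : ((Finset.Ico r t).card : ℝ) ≤ t := by
    rw [Nat.card_Ico]; exact_mod_cast Nat.sub_le t r
  refine le_of_sq_le_sq ?_ (by positivity)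
  rw [mul_pow, mul_pow, mul_pow, Real.sq_sqrt hlog, Real.sq_sqrt (by positivity)]
  calc _ ≤ _ := h1
    _ ≤ t * (8 * σ ^ 2 * DK * Real.log t * (2 * √(t : ℝ))) := by gcongr
    _ = _ := by ring

lemma mul_confRadius_le {K : ℕ} (hK : 1 ≤ K) {σ DK : ℝ} (hσ : 0 ≤ σ) (hDK : 0 ≤ DK) {t : ℕ}
    (ht : 10 * K ^ 4 ≤ t) :
    t * confRadius K σ DK t ≤ 3 * σ * (√(Real.log t) * √(DK * (t * √(t : ℝ)))) := by
  have hr1 : 1 ≤ t := le_trans (by nlinarith [Nat.one_le_pow 4 K hK]) ht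
  have ht1 : (1 : ℝ) ≤ t := by exact_mod_cast hr1
  have hlog : 0 ≤ Real.log t := Real.log_nonneg ht1
  refine le_of_sq_le_sq ?_ (by positivity)
  rw [mul_pow, mul_pow, mul_pow, mul_pow, Real.sq_sqrt hlog, Real.sq_sqrt (by positivity)]
  have hs : 0 < √(t : ℝ) := Real.sqrt_pos.2 (by linarith)
  have hss : √(t : ℝ) ^ 2 = t := Real.sq_sqrt (by linarith)
  calc (t : ℝ) ^ 2 * confRadius K σ DK t ^ 2
      ≤ (t : ℝ) ^ 2 * (8 * σ ^ 2 * DK * Real.log t / √(t : ℝ)) := by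
        gcongr; exact confRadius_sq_le hK hDK ht le_rfl
    _ = 8 * (σ ^ 2 * (Real.log t * (DK * (t * √(t : ℝ))))) := by
        field_simp
        rw [hss]
        ring
    _ ≤ 9 * (σ ^ 2 * (Real.log t * (DK * (t * √(t : ℝ))))) := by
        gcongr; norm_num
    _ = _ := by ring

/-- The lower-order term of the bound. -/
noncomputable def lowerOrder (C : ℝ) (K : ℕ) (DK : ℝ) (t : ℕ) : ℝ :=
  C * √(2 + Real.log t) * ((K : ℝ) ^ 2 * √(DK * t) + √(DK * (t * √(t : ℝ))))

lemma lowerOrder_pos {C : ℝ} (hC : 0 < C) (K : ℕ) {DK : ℝ} (hDK : 0 < DK) {t : ℕ} (ht : 1 ≤ t) :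
    0 < lowerOrder C K DK t := by
  have ht1 : (1 : ℝ) ≤ t := by exact_mod_cast ht
  have hlog : 0 ≤ Real.log t := Real.log_nonneg ht1
  have : 0 < √(2 + Real.log t) := Real.sqrt_pos.2 (by linarith)
  have : 0 < √(DK * (t * √(t : ℝ))) := Real.sqrt_pos.2 (by positivity)
  unfold lowerOrder
  positivity

lemma lowerOrder_le {C : ℝ} (hC : 0 ≤ C) {K : ℕ} (hK : 1 ≤ K) {DK : ℝ} {t : ℕ} (ht : 1 ≤ t) :
    lowerOrder C K DK t ≤ 2 * C * (1 + Real.log (K * t)) ^ 1 *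
      ((K : ℝ) ^ 2 * √(DK * t) + √(DK * (t : ℝ) ^ (3 / 2 : ℝ))) := by
  have ht1 : (1 : ℝ) ≤ t := by exact_mod_cast ht
  have hK1 : (1 : ℝ) ≤ K := by exact_mod_cast hK
  have hlog : 0 ≤ Real.log t := Real.log_nonneg ht1
  have hpow : (t : ℝ) ^ (3 / 2 : ℝ) = t * √(t : ℝ) := by
    rw [Real.sqrt_eq_rpow, ← Real.rpow_one_add' (by linarith) (by norm_num)]
    norm_num
  have hle : Real.log t ≤ Real.log (K * t) :=
    Real.log_le_log (by linarith) (by nlinarith)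
  have hsq : √(2 + Real.log t) ≤ 2 * (1 + Real.log (K * t)) :=
    Real.sqrt_le_iff.2 ⟨by linarith, by nlinarith⟩
  rw [hpow, pow_one, lowerOrder]
  gcongr ?_ * _
  calc C * √(2 + Real.log t) ≤ C * (2 * (1 + Real.log (K * t))) := by gcongr
    _ = _ := by ring

/-- Both terms reduce to (2 + log t)/√t, which is nonincreasing from t = 1 on; the constant 2 in
`lowerOrder` is there for this. -/
lemma lowerOrder_div_antitone {C : ℝ} (hC : 0 ≤ C) {K : ℕ} {DK : ℝ} (hDK : 0 ≤ DK) {s t : ℕ}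
    (hs : 1 ≤ s) (hst : s ≤ t) : lowerOrder C K DK t / t ≤ lowerOrder C K DK s / s := by
  have h1 : ∀ t : ℕ, 1 ≤ t → lowerOrder C K DK t / t
      = C * ((K : ℝ) ^ 2 * √(DK * ((2 + Real.log t) / √(t : ℝ) / √(t : ℝ)))
        + √(DK * ((2 + Real.log t) / √(t : ℝ)))) := by
    intro t ht
    have ht1 : (1 : ℝ) ≤ t := by exact_mod_cast ht
    have hlog : 0 ≤ Real.log t := Real.log_nonneg ht1
    have hs : 0 < √(t : ℝ) := Real.sqrt_pos.2 (by linarith)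
    have hss : √(t : ℝ) * √(t : ℝ) = t := Real.mul_self_sqrt (by linarith)
    have e : ∀ x y : ℝ, 0 ≤ y → (2 + Real.log t) * x = (t : ℝ) ^ 2 * y →
        √(2 + Real.log t) * √x = t * √y := by
      intro x y hy h
      rw [← Real.sqrt_mul (by linarith), h, Real.sqrt_mul (by positivity),
        Real.sqrt_sq (by linarith)]
    rw [div_eq_iff (by linarith), lowerOrder, mul_assoc, mul_assoc, mul_add, mul_left_comm,
      e _ (DK * ((2 + Real.log t) / √(t : ℝ) / √(t : ℝ))) (by positivity),
      e _ (DK * ((2 + Real.log t) / √(t : ℝ))) (by positivity)]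
    · ring
    · field_simp
      rw [pow_two, hss]
    · rw [div_div, hss]; field_simp
  have hφ : (2 + Real.log t) / √(t : ℝ) ≤ (2 + Real.log s) / √(s : ℝ) := by
    have hs1 : (1 : ℝ) ≤ s := by exact_mod_cast hs
    have hst' : (s : ℝ) ≤ t := by exact_mod_cast hst
    have p1 : 0 < √(s : ℝ) := Real.sqrt_pos.2 (by linarith)
    have p2 : 0 < √(t : ℝ) := Real.sqrt_pos.2 (by linarith)
    have hlog : 0 ≤ Real.log s := Real.log_nonneg hs1
    have hle : √(s : ℝ) ≤ √(t : ℝ) := Real.sqrt_le_sqrt hst'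
    have h := Real.log_le_sub_one_of_pos (div_pos p2 p1)
    rw [Real.log_div p2.ne' p1.ne', Real.log_sqrt (by linarith), Real.log_sqrt (by linarith),
      le_sub_iff_add_le, le_div_iff₀ p1] at h
    rw [div_le_div_iff₀ p2 p1]
    nlinarith
  have hφ0 : 0 ≤ (2 + Real.log t) / √(t : ℝ) := by
    have : 0 ≤ Real.log t := Real.log_nonneg (by exact_mod_cast hs.trans hst)
    positivity
  rw [h1 t (hs.trans hst), h1 s hs]
  have p1 : 0 < √(s : ℝ) := Real.sqrt_pos.2 (by exact_mod_cast hs)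
  have hle : √(s : ℝ) ≤ √(t : ℝ) := Real.sqrt_le_sqrt (by exact_mod_cast hst)
  gcongr

/-! ### Stability of gains and values under perturbation of the means. -/

section Gain

variable {K : ℕ} {I : Type*} {E : ExpFamily} {Q : Problem K I} {a b : ℝ}

lemma d_le_add (hΘ : Set.Icc a b ⊆ E.Θ) {p p' q r : ℝ} (hp : p ∈ Set.Icc a b)
    (hp' : p' ∈ Set.Icc a b) (hq : q ∈ Set.Icc a b) (h : |p - p'| ≤ r) :
    E.d p q ≤ E.d p' q + ENNReal.ofReal (|E.ν b - E.ν a| * r) := by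
  have h1 := ExpFamily.toReal_d_le_add hΘ hp hp' hq
  have h2 := mul_le_mul_of_nonneg_left h (abs_nonneg (E.ν b - E.ν a))
  have h0 : 0 ≤ |E.ν b - E.ν a| * r := le_trans (by positivity) h2
  rw [← ENNReal.ofReal_toReal (E.d_ne_top (hΘ hp) (hΘ hq)),
    ← ENNReal.ofReal_toReal (E.d_ne_top (hΘ hp') (hΘ hq)),
    ← ENNReal.ofReal_add ENNReal.toReal_nonneg h0]
  exact ENNReal.ofReal_le_ofReal (by linarith)

lemma sum_ofReal_stdSimplex {w : Fin K → ℝ} (hw : w ∈ stdSimplex ℝ (Fin K)) :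
    ∑ k, ENNReal.ofReal (w k) = 1 := by
  rw [← ENNReal.ofReal_sum_of_nonneg fun k _ => hw.1 k, hw.2, ENNReal.ofReal_one]

lemma sum_mul_d_le_add (hΘ : Set.Icc a b ⊆ E.Θ) {m m' l w : Fin K → ℝ} {r : ℝ}
    (hm : ∀ k, m k ∈ Set.Icc a b) (hm' : ∀ k, m' k ∈ Set.Icc a b) (hl : ∀ k, l k ∈ Set.Icc a b)
    (h : ∀ k, |m k - m' k| ≤ r) (hw : w ∈ stdSimplex ℝ (Fin K)) :
    ∑ k, ENNReal.ofReal (w k) * E.d (m k) (l k) ≤ ∑ k, ENNReal.ofReal (w k) * E.d (m' k) (l k)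
      + ENNReal.ofReal (|E.ν b - E.ν a| * r) := by
  calc _ ≤ ∑ k, ENNReal.ofReal (w k) * (E.d (m' k) (l k)
        + ENNReal.ofReal (|E.ν b - E.ν a| * r)) := by
        gcongr with k
        exact d_le_add hΘ (hm k) (hm' k) (hl k) (h k)
    _ = _ := by
        simp_rw [mul_add]
        rw [Finset.sum_add_distrib, ← Finset.sum_mul, sum_ofReal_stdSimplex hw, one_mul]

lemma sum_ofReal_mul_d {w m l : Fin K → ℝ} (hw : ∀ k, 0 ≤ w k) (hm : ∀ k, m k ∈ E.Θ)
    (hl : ∀ k, l k ∈ E.Θ) : ∑ k, ENNReal.ofReal (w k) * E.d (m k) (l k)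
      = ENNReal.ofReal (∑ k, w k * (E.d (m k) (l k)).toReal) := by
  rw [ENNReal.ofReal_sum_of_nonneg fun k _ => mul_nonneg (hw k) ENNReal.toReal_nonneg]
  refine Finset.sum_congr rfl fun k _ => ?_
  rw [ENNReal.ofReal_mul (hw k), ENNReal.ofReal_toReal (E.d_ne_top (hm k) (hl k))]

lemma gain_le_add (hΘ : Set.Icc a b ⊆ E.Θ) (hM : ∀ l ∈ Q.M, ∀ k, l k ∈ Set.Icc a b)
    {m m' w : Fin K → ℝ} {r : ℝ} (hm : ∀ k, m k ∈ Set.Icc a b) (hm' : ∀ k, m' k ∈ Set.Icc a b)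
    (h : ∀ k, |m k - m' k| ≤ r) (hw : w ∈ stdSimplex ℝ (Fin K)) (i : I) :
    gain E Q m w i ≤ gain E Q m' w i + ENNReal.ofReal (|E.ν b - E.ν a| * r) := by
  simp only [gain, ENNReal.iInf_add]
  exact le_iInf₂ fun l hl =>
    (iInf₂_le l hl).trans (sum_mul_d_le_add hΘ hm hm' (hM l hl.1) h hw)

lemma value_le_add (hΘ : Set.Icc a b ⊆ E.Θ) (hM : ∀ l ∈ Q.M, ∀ k, l k ∈ Set.Icc a b)
    {m m' : Fin K → ℝ} {r : ℝ} (hm : ∀ k, m k ∈ Set.Icc a b) (hm' : ∀ k, m' k ∈ Set.Icc a b)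
    (h : ∀ k, |m k - m' k| ≤ r) (i : I) :
    value E Q m i ≤ value E Q m' i + ENNReal.ofReal (|E.ν b - E.ν a| * r) :=
  iSup₂_le fun w hw => (gain_le_add hΘ hM hm hm' h hw i).trans <| by
    gcongr
    exact le_iSup₂_of_le (f := fun w (_ : w ∈ stdSimplex ℝ (Fin K)) => gain E Q m' w i) w hw le_rfl

lemma invTStar_eq_value {m : Fin K → ℝ} {i : I} (hi : i ∈ iF E Q m) :
    invTStar E Q m = value E Q m i := by
  refine le_antisymm (iSup₂_le fun w hw => iSup_le fun j => ?_) (iSup₂_mono fun w _ =>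
    le_iSup (fun j => gain E Q m w j) i)
  exact (le_iSup₂_of_le (f := fun w (_ : w ∈ stdSimplex ℝ (Fin K)) => gain E Q m w j) w hw
    le_rfl).trans (hi j)

lemma value_eq_zero {m : Fin K → ℝ} (hm : ∀ k, m k ∈ E.Θ) {i : I} (hi : m ∈ Q.alt i) :
    value E Q m i = 0 := by
  refine le_antisymm (iSup₂_le fun w _ => (iInf₂_le m hi).trans ?_) zero_le
  simp [E.d_self (hm _)]

lemma iF_nonempty [Finite I] [Nonempty I] (m : Fin K → ℝ) : (iF E Q m).Nonempty :=
  Finite.exists_max (value E Q m)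

/-- If `T*(m)⁻¹` is infinite, some answer is correct for all models. -/
lemma exists_alt_eq_empty (hΘ : Set.Icc a b ⊆ E.Θ) (hM : ∀ l ∈ Q.M, ∀ k, l k ∈ Set.Icc a b)
    {m : Fin K → ℝ} (hm : m ∈ Q.M) (h : invTStar E Q m = ∞) : ∃ i, Q.alt i = ∅ := by
  by_contra! hne
  have hbd : invTStar E Q m ≤ ENNReal.ofReal (|E.ν b - E.ν a| * |b - a|) := by
    refine iSup₂_le fun w hw => iSup_le fun i => ?_
    obtain ⟨l, hl⟩ := hne i
    refine (iInf₂_le l hl).trans ?_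
    calc ∑ k, ENNReal.ofReal (w k) * E.d (m k) (l k)
        ≤ ∑ k, ENNReal.ofReal (w k) * ENNReal.ofReal (|E.ν b - E.ν a| * |b - a|) := by
          gcongr with k
          rw [← ENNReal.ofReal_toReal (E.d_ne_top (hΘ (hM m hm k)) (hΘ (hM l hl.1 k)))]
          exact ENNReal.ofReal_le_ofReal
            (ExpFamily.toReal_d_le hΘ (hM m hm k) (hM l hl.1 k))
      _ = _ := by rw [← Finset.sum_mul, sum_ofReal_stdSimplex hw, one_mul]
  rw [h] at hbd
  exact ENNReal.ofReal_ne_top (top_le_iff.1 hbd)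

lemma stopStat_eq_top {act : ℕ → Fin K} {x : ℕ → ℝ} {i : I} (hi : Q.alt i = ∅) (t : ℕ) :
    stopStat E Q act x t = ∞ := by
  refine top_le_iff.1 (le_iSup_of_le i ?_)
  simp [gain, hi]

end Gain

/-! ### Pathwise lower bound for the stopping statistic. -/

section Deterministic

variable {K : ℕ} {I : Type*} {E : ExpFamily} {Q : Problem K I} {σ μmin μmax DK : ℝ}
  {a : ℕ → Fin K} {x : ℕ → ℝ}

/-- The projected empirical means are close to every model of the confidence region. -/
lemma abs_projMean_sub_le (hσ : 0 < σ) (hE : E.SubGaussian σ) (hΘ : Set.Icc μmin μmax ⊆ E.Θ)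
    (hDK : 0 ≤ DK) {s : ℕ} (hs : 1 ≤ s) (hden : 0 < √((s : ℝ) + (K : ℝ) ^ 2) - 2 * K)
    {l : Fin K → ℝ} (hl : ∀ k, l k ∈ Set.Icc μmin μmax)
    (hconf : ∑ k, (pulls a k s : ℝ≥0∞) * E.d (empMean a x s k) (l k)
      ≤ ENNReal.ofReal (DK * Real.log s)) (k : Fin K)
    (hN : √((s : ℝ) + (K : ℝ) ^ 2) - 2 * K ≤ (pulls a k s : ℝ)) :
    |projMean μmin μmax a x s k - l k| ≤ confRadius K σ DK s := by
  have hp : projMean μmin μmax a x s k ∈ Set.Icc μmin μmax :=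
    ExpFamily.proj_mem ((hl k).1.trans (hl k).2) _
  set p := projMean μmin μmax a x s k
  set N := √((s : ℝ) + (K : ℝ) ^ 2) - 2 * K
  have h1 : (pulls a k s : ℝ≥0∞) * E.d (empMean a x s k) (l k) ≤ ENNReal.ofReal (DK * Real.log s) :=
    (Finset.single_le_sum (f := fun k => (pulls a k s : ℝ≥0∞) * E.d (empMean a x s k) (l k))
      (fun _ _ => zero_le) (Finset.mem_univ k)).trans hconf
  -- Sub-Gaussianity is available only inside Θ, hence the passage through the projected mean.
  have h2 : ENNReal.ofReal ((p - l k) ^ 2 / (2 * σ ^ 2)) ≤ E.d (empMean a x s k) (l k) :=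
    (hE p (hΘ hp) (l k) (hΘ (hl k))).trans (ExpFamily.d_proj_le hΘ (hl k) _)
  have h3 : ENNReal.ofReal (N * ((p - l k) ^ 2 / (2 * σ ^ 2)))
      ≤ ENNReal.ofReal (DK * Real.log s) := by
    rw [ENNReal.ofReal_mul hden.le]
    refine le_trans (mul_le_mul' ?_ h2) h1
    rw [← ENNReal.ofReal_natCast]
    exact ENNReal.ofReal_le_ofReal hN
  have hlog : 0 ≤ Real.log s := Real.log_nonneg (by exact_mod_cast hs)
  rw [ENNReal.ofReal_le_ofReal_iff (by positivity)] at h3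
  refine Real.abs_le_sqrt ?_
  rw [le_div_iff₀ hden]
  rw [← mul_div_assoc, div_le_iff₀ (by positivity)] at h3
  linarith

/-- In a round in which the true model is in the confidence region, the weights of the algorithm
gain nearly `T*(μ)⁻¹` against the alternatives of the first oracle answer. -/
lemma invTStar_le_sum_add [LinearOrder I] (hΘ : Set.Icc μmin μmax ⊆ E.Θ)
    (hM : ∀ l ∈ Q.M, ∀ k, l k ∈ Set.Icc μmin μmax) {μ : Fin K → ℝ} (hμ : μ ∈ Q.M) {ε : ℝ}
    (hiF : ∀ μ' ∈ Q.M, dist μ μ' ≤ ε → iF E Q μ' ⊆ iF E Q μ ∪ (Q.iStar μ)ᶜ)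
    {s : ℕ} {r : ℝ} (hr : 0 ≤ r) (hrε : 2 * r ≤ ε) (hconf : μ ∈ confRegion E Q DK a x s)
    (hnear : ∀ l ∈ confRegion E Q DK a x s, ∀ k, |projMean μmin μmax a x s k - l k| ≤ r)
    {ans i : I} {w : Fin K → ℝ} (hi : IsLeast (iF E Q μ) i)
    (hans : IsLeast (candidates E Q DK a x s) ans)
    (hw : w ∈ oracleWeights E Q (projMean μmin μmax a x s) ans) {l : Fin K → ℝ}
    (hl : l ∈ Q.alt i) :
    invTStar E Q μ ≤ ∑ k, ENNReal.ofReal (w k) * E.d (μ k) (l k)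
      + 4 * ENNReal.ofReal (|E.ν μmax - E.ν μmin| * r) := by
  set m := projMean μmin μmax a x s
  set c := ENNReal.ofReal (|E.ν μmax - E.ν μmin| * r)
  have hμB := hM μ hμ
  have hm : ∀ k, m k ∈ Set.Icc μmin μmax := fun k =>
    ExpFamily.proj_mem ((hμB k).1.trans (hμB k).2) _
  have hmμ : ∀ k, |m k - μ k| ≤ r := hnear μ hconf
  have hμm : ∀ k, |μ k - m k| ≤ r := fun k => by rw [abs_sub_comm]; exact hmμ k
  rw [invTStar_eq_value hi.1]
  obtain ⟨lam, hlam, hans'⟩ := Set.mem_iUnion₂.1 hans.1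
  have hmlam : ∀ k, |m k - lam k| ≤ r := hnear lam hlam
  have hlamm : ∀ k, |lam k - m k| ≤ r := fun k => by rw [abs_sub_comm]; exact hmlam k
  have hlamB := hM lam hlam.1
  have hdist : dist μ lam ≤ ε := by
    refine (dist_pi_le_iff (by linarith)).2 fun k => ?_
    rw [Real.dist_eq]
    have := abs_sub_le (μ k) (m k) (lam k)
    linarith [hμm k, hmlam k]
  rcases hiF lam hlam.1 hdist hans' with hmem | hmem
  -- Stickiness: i is a candidate because μ is in the region, so the least candidate, being itself
  -- an oracle answer of μ, equals i.
  · have hai : ans = i := le_antisymm (hans.2 (Set.mem_biUnion hconf hi.1)) (hi.2 hmem)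
    subst hai
    calc value E Q μ ans ≤ value E Q m ans + c := value_le_add hΘ hM hμB hm hμm ans
      _ ≤ gain E Q m w ans + c := by gcongr; exact iSup₂_le hw.2
      _ ≤ (gain E Q μ w ans + c) + c := by gcongr; exact gain_le_add hΘ hM hm hμB hmμ hw.1 ans
      _ ≤ (∑ k, ENNReal.ofReal (w k) * E.d (μ k) (l k) + c) + c := by
          gcongr
          exact iInf₂_le l hl
      _ = ∑ k, ENNReal.ofReal (w k) * E.d (μ k) (l k) + 2 * c := by ring
      _ ≤ _ := by gcongr; norm_num
  -- Here `ans` is wrong for μ and has value 0 at μ. The path μ → m → lam → m → μ, with `ans`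
  -- optimal at lam, bounds T*(μ)⁻¹ by 4c.
  · calc value E Q μ i ≤ value E Q m i + c := value_le_add hΘ hM hμB hm hμm i
      _ ≤ (value E Q lam i + c) + c := by gcongr; exact value_le_add hΘ hM hm hlamB hmlam i
      _ ≤ (value E Q lam ans + c) + c := by gcongr; exact hans' i
      _ ≤ ((value E Q m ans + c) + c) + c := by
          gcongr; exact value_le_add hΘ hM hlamB hm hlamm ans
      _ ≤ (((value E Q μ ans + c) + c) + c) + c := by
          gcongr; exact value_le_add hΘ hM hm hμB hmμ ans
      _ = 4 * c := by rw [value_eq_zero (fun k => hΘ (hμB k)) ⟨hμ, hmem⟩]; ring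
      _ ≤ _ := le_add_self

/-- A constant for the lower-order term. -/
noncomputable def lowerOrderConst (E : ExpFamily) (σ μmin μmax : ℝ) : ℝ :=
  19 * |E.ν μmax - E.ν μmin| * σ + 2 * (|E.ν μmax - E.ν μmin| * |μmax - μmin|) + 1

lemma lowerOrderConst_pos (E : ExpFamily) (hσ : 0 < σ) (μmin μmax : ℝ) :
    0 < lowerOrderConst E σ μmin μmax := by unfold lowerOrderConst; positivity

/-- If the true model is in the confidence regions of the rounds from `√t` to `t`, the stopping
statistic at time `t` is large. -/
lemma ofReal_le_stopStat [Finite I] [LinearOrder I] (hσ : 0 < σ) (hE : E.SubGaussian σ)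
    (hΘ : Set.Icc μmin μmax ⊆ E.Θ) (hK : 1 ≤ K) (hDK : 1 ≤ DK)
    (hM : ∀ l ∈ Q.M, ∀ k, l k ∈ Set.Icc μmin μmax) {μ : Fin K → ℝ} (hμ : μ ∈ Q.M) {ε : ℝ}
    (hε : 0 < ε) (hiF : ∀ μ' ∈ Q.M, dist μ μ' ≤ ε → iF E Q μ' ⊆ iF E Q μ ∪ (Q.iStar μ)ᶜ)
    (hfollow : FollowsStickyTaS E Q μmin μmax DK a x) {t : ℕ}
    (ht : (Tmu K σ DK ε : ℝ) < t - √(t : ℝ) - 1)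
    (hgood : ∀ s : ℕ, √(t : ℝ) ≤ s → s ≤ t →
      ∑ k, (pulls a k s : ℝ≥0∞) * E.d (empMean a x s k) (μ k) ≤ ENNReal.ofReal (DK * Real.log s)) :
    ENNReal.ofReal ((t - √(t : ℝ) - 1 - Tmu K σ DK ε) * (invTStar E Q μ).toReal
      - lowerOrder (lowerOrderConst E σ μmin μmax) K DK t) ≤ stopStat E Q a x t := by
  obtain ⟨hinit, ans, w, wt, halg⟩ := hfollow
  have : Nonempty I := ⟨ans K⟩
  have hDK0 : 0 ≤ DK := by linarith
  set T := Tmu K σ DK ε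
  set R := (invTStar E Q μ).toReal
  set L := |E.ν μmax - E.ν μmin| with hL
  have hL0 : 0 ≤ L := abs_nonneg _
  set ρ := confRadius K σ DK
  have hT10 : 10 * K ^ 4 ≤ T := le_max_left _ _
  have hKT : K ≤ T :=
    le_trans (by nlinarith [Nat.pow_le_pow_right hK (show 1 ≤ 4 by norm_num)]) hT10
  have hμB := hM μ hμ
  have hTt : T ≤ t := by
    have : (T : ℝ) ≤ t := by linarith [Real.sqrt_nonneg (t : ℝ)]
    exact_mod_cast this
  have htrack : IsCTracking a wt :=
    ⟨hinit, fun s hs => (halg s hs).2.2.1.1.1, fun s hs => (halg s hs).2.2.2⟩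
  have hpulls : ∀ s, T ≤ s → ∀ k, √((s : ℝ) + (K : ℝ) ^ 2) - 2 * K ≤ (pulls a k s : ℝ) :=
    fun s hs k => htrack.sqrt_sub_le_pulls
      (fun r hr k => ((halg r hr).2.2.1.1.2 k).1) (hKT.trans hs) k
  have hden : ∀ s, T ≤ s → 0 < √((s : ℝ) + (K : ℝ) ^ 2) - 2 * K := fun s hs => by
    obtain ⟨h1, h2⟩ := sqrt_sub_pos_and_le hK (hT10.trans hs)
    have : (1 : ℝ) ≤ K := by exact_mod_cast hK
    nlinarith
  have hnear : ∀ s, T ≤ s → ∀ l ∈ confRegion E Q DK a x s, ∀ k,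
      |projMean μmin μmax a x s k - l k| ≤ ρ s := fun s hs l hl k =>
    abs_projMean_sub_le hσ hE hΘ hDK0 (by omega) (hden s hs) (hM l hl.1) hl.2 k (hpulls s hs k)
  obtain ⟨i, hi⟩ : ∃ i, IsLeast (iF E Q μ) i := by
    obtain ⟨i, hi, hmin⟩ :=
      Set.exists_min_image _ id (Set.toFinite _) (iF_nonempty (E := E) (Q := Q) μ)
    exact ⟨i, hi, fun j hj => hmin j hj⟩
  refine le_iSup_of_le i (le_iInf₂ fun l hl => ?_)
  have hlB := hM l hl.1
  set D : Fin K → ℝ := fun k => (E.d (μ k) (l k)).toReal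
  have hD0 : ∀ k, 0 ≤ D k := fun k => ENNReal.toReal_nonneg
  have hDmax : ∀ k, D k ≤ L * |μmax - μmin| := fun k => ExpFamily.toReal_d_le hΘ (hμB k) (hlB k)
  -- Only rounds from r to t - 1 are counted: there μ is in the region and 2ρ_s ≤ ε.
  set r := max ⌈√(t : ℝ)⌉₊ T
  have hTr : T ≤ r := le_max_right _ _
  have hKr : K ≤ r := hKT.trans hTr
  have hr_le : (r : ℝ) ≤ √(t : ℝ) + 1 + T := by
    rw [Nat.cast_max]
    have := (Nat.ceil_lt_add_one (Real.sqrt_nonneg (t : ℝ))).le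
    exact max_le (by linarith [T.cast_nonneg (α := ℝ)]) (by linarith [Real.sqrt_nonneg (t : ℝ)])
  have hrt : r ≤ t := by
    have : (r : ℝ) ≤ t := by linarith
    exact_mod_cast this
  have hwS : ∀ s, K ≤ s → w s ∈ stdSimplex ℝ (Fin K) := fun s hs => (halg s hs).2.1.1
  have hround : ∀ s ∈ Finset.Ico r t, R ≤ ∑ k, w s k * D k + 4 * (L * ρ s) := by
    intro s hs
    obtain ⟨hrs, hst⟩ := Finset.mem_Ico.1 hs
    have hTs : T ≤ s := hTr.trans hrs
    have hKs : K ≤ s := hKr.trans hrs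
    have hsqrt : √(t : ℝ) ≤ s := (Nat.le_ceil _).trans
      (by exact_mod_cast (le_max_left _ _ : ⌈√(t : ℝ)⌉₊ ≤ r).trans hrs)
    have hconf : μ ∈ confRegion E Q DK a x s := ⟨hμ, hgood s hsqrt hst.le⟩
    have hρ : 0 ≤ ρ s := confRadius_nonneg _ _ _ _
    have h := invTStar_le_sum_add hΘ hM hμ hiF hρ (two_mul_confRadius_le hK hDK0 hε hTs) hconf
      (hnear s hTs) hi ((halg s hKs).1 ⟨i, Set.mem_biUnion hconf hi.1⟩) (halg s hKs).2.1 hl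
    rw [sum_ofReal_mul_d (hwS s hKs).1 (fun k => hΘ (hμB k)) fun k => hΘ (hlB k),
      show (4 : ℝ≥0∞) = ENNReal.ofReal 4 by simp, ← ENNReal.ofReal_mul (by norm_num),
      ← ENNReal.ofReal_add (Finset.sum_nonneg fun k _ => mul_nonneg ((hwS s hKs).1 k) (hD0 k))
        (by positivity)] at h
    exact ENNReal.toReal_le_of_le_ofReal (add_nonneg
      (Finset.sum_nonneg fun k _ => mul_nonneg ((hwS s hKs).1 k) (hD0 k)) (by positivity)) h
  have hrounds : (t - √(t : ℝ) - 1 - T) * R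
      ≤ ∑ s ∈ Finset.Ico r t, ∑ k, w s k * D k + 4 * L * ∑ s ∈ Finset.Ico r t, ρ s := by
    calc (t - √(t : ℝ) - 1 - T) * R ≤ ((t : ℝ) - r) * R :=
          mul_le_mul_of_nonneg_right (by linarith) ENNReal.toReal_nonneg
      _ = ∑ _s ∈ Finset.Ico r t, R := by simp [Nat.cast_sub hrt]
      _ ≤ ∑ s ∈ Finset.Ico r t, (∑ k, w s k * D k + 4 * (L * ρ s)) := Finset.sum_le_sum hround
      _ = _ := by
          rw [Finset.sum_add_distrib, Finset.mul_sum]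
          simp_rw [mul_assoc]
  have hpullsD : ∑ s ∈ Finset.Ico r t, ∑ k, w s k * D k
      ≤ ∑ k, (pulls a k t : ℝ) * D k + (K : ℝ) ^ 2 * (√(t : ℝ) + 1) * (L * |μmax - μmin|) := by
    have hk : ∀ k, ∑ s ∈ Finset.Ico r t, w s k * D k ≤ (pulls a k t : ℝ) * D k
        + K * (√(t : ℝ) + 1) * (L * |μmax - μmin|) := by
      intro k
      have h1 : ∑ s ∈ Finset.Ico r t, w s k ≤ ∑ s ∈ Finset.Ico K t, w s k :=
        Finset.sum_le_sum_of_subset_of_nonneg (Finset.Ico_subset_Ico hKr le_rfl)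
          fun s hs _ => (hwS s (Finset.mem_Ico.1 hs).1).1 k
      have h2 := htrack.sum_sub_le_pulls (w := w) (fun s hs k => (halg s hs).2.2.1.abs_sub_le
        (explore_nonneg K s) (mul_explore_le_one K s) (hwS s hs) k) (hKr.trans hrt) k
      have h3 : ∑ s ∈ Finset.Ico r t, w s k ≤ (pulls a k t : ℝ) + K * (√(t : ℝ) + 1) := by
        linarith
      have h4 := mul_le_mul_of_nonneg_right h3 (hD0 k)
      have h5 := mul_le_mul_of_nonneg_left (hDmax k)
        (by positivity : 0 ≤ K * (√(t : ℝ) + 1))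
      rw [← Finset.sum_mul]
      linarith
    rw [Finset.sum_comm]
    refine (Finset.sum_le_sum fun k _ => hk k).trans ?_
    rw [Finset.sum_add_distrib, Finset.sum_const, Finset.card_univ, Fintype.card_fin,
      nsmul_eq_mul]
    refine le_of_eq ?_
    ring
  have hfinal : ∑ k, (pulls a k t : ℝ) * D k ≤ ∑ k, (pulls a k t : ℝ) *
      (E.d (projMean μmin μmax a x t k) (l k)).toReal + L * (t * ρ t) := by
    have hconf : μ ∈ confRegion E Q DK a x t := by
      refine ⟨hμ, hgood t (Real.sqrt_le_iff.2 ⟨t.cast_nonneg, ?_⟩) le_rfl⟩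
      have : (1 : ℝ) ≤ t := by exact_mod_cast (by omega : 1 ≤ t)
      nlinarith
    calc ∑ k, (pulls a k t : ℝ) * D k ≤ ∑ k, (pulls a k t : ℝ) *
          ((E.d (projMean μmin μmax a x t k) (l k)).toReal + L * ρ t) := by
          gcongr with k
          have hm : projMean μmin μmax a x t k ∈ Set.Icc μmin μmax :=
            ExpFamily.proj_mem ((hμB k).1.trans (hμB k).2) _
          have h1 := ExpFamily.toReal_d_le_add hΘ (hμB k) hm (hlB k)
          have h2 := mul_le_mul_of_nonneg_left (hnear t hTt μ hconf k) hL0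
          rw [abs_sub_comm] at h2
          linarith
      _ = _ := by
          simp_rw [mul_add]
          rw [Finset.sum_add_distrib, ← Finset.sum_mul, IsCTracking.sum_pulls_cast]
          ring
  -- The stopping rule uses unprojected means, whose divergences to models in the box are only
  -- larger.
  have hproj : ENNReal.ofReal (∑ k, (pulls a k t : ℝ) *
      (E.d (projMean μmin μmax a x t k) (l k)).toReal)
      ≤ ∑ k, ENNReal.ofReal (pulls a k t : ℝ) * E.d (empMean a x t k) (l k) := by
    have hm : ∀ k, projMean μmin μmax a x t k ∈ E.Θ := fun k =>
      hΘ (ExpFamily.proj_mem ((hμB k).1.trans (hμB k).2) _)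
    rw [← sum_ofReal_mul_d (w := fun k => (pulls a k t : ℝ)) (fun k => Nat.cast_nonneg _) hm
      fun k => hΘ (hlB k)]
    gcongr with k
    exact ExpFamily.d_proj_le hΘ (hlB k) _
  refine le_trans (ENNReal.ofReal_le_ofReal ?_) hproj
  have hs1 := sum_confRadius_le hK hσ.le hDK0 (hT10.trans hTr) hrt
  have hs2 := mul_confRadius_le hK hσ.le hDK0 (hT10.trans hTt)
  have ht1 : (1 : ℝ) ≤ t := by exact_mod_cast (by omega : 1 ≤ t)
  have hlog : 0 ≤ Real.log t := Real.log_nonneg ht1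
  set q := √(DK * (t * √(t : ℝ)))
  have hq : 0 ≤ q := Real.sqrt_nonneg _
  set z := √(2 + Real.log t) with hz
  have hz1 : 1 ≤ z := Real.one_le_sqrt.2 (by linarith)
  have hzlog : √(Real.log t) ≤ z := Real.sqrt_le_sqrt (by linarith)
  set y := √(DK * (t : ℝ)) with hy
  have hyt : √(t : ℝ) ≤ y := Real.sqrt_le_sqrt (by nlinarith)
  have hy1 : 1 ≤ √(t : ℝ) := Real.one_le_sqrt.2 ht1
  have b1 : √(Real.log t) * q ≤ z * q := by gcongr
  -- 19 = 4 · 4 + 3, from the sum of the radii and from the last radius.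
  have b2 : 4 * L * ∑ s ∈ Finset.Ico r t, ρ s + L * (t * ρ t) ≤ 19 * L * σ * (z * q) := by
    have c1 := mul_le_mul_of_nonneg_left hs1 (by positivity : 0 ≤ 4 * L)
    have c2 := mul_le_mul_of_nonneg_left hs2 hL0
    have c3 := mul_le_mul_of_nonneg_left b1 (by positivity : 0 ≤ 19 * L * σ)
    linarith
  set M := L * |μmax - μmin|
  have hM0 : 0 ≤ M := by positivity
  have b3 : (K : ℝ) ^ 2 * (√(t : ℝ) + 1) * M ≤ 2 * M * (z * ((K : ℝ) ^ 2 * y)) := by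
    have c1 : √(t : ℝ) + 1 ≤ 2 * (z * y) := by nlinarith
    have c2 := mul_le_mul_of_nonneg_left c1 (by positivity : 0 ≤ (K : ℝ) ^ 2 * M)
    linarith
  have b4 : 19 * L * σ * (z * q) + 2 * M * (z * ((K : ℝ) ^ 2 * y))
      ≤ lowerOrder (lowerOrderConst E σ μmin μmax) K DK t := by
    have d1 : lowerOrder (lowerOrderConst E σ μmin μmax) K DK t
        = (19 * L * σ + 2 * M + 1) * (z * ((K : ℝ) ^ 2 * y) + z * q) := by
      simp only [lowerOrder, lowerOrderConst]
      ring
    rw [d1]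
    have p1 : 0 ≤ z * q := by positivity
    have p2 : 0 ≤ z * ((K : ℝ) ^ 2 * y) := by positivity
    have p3 : 0 ≤ L * σ := by positivity
    nlinarith [mul_nonneg p3 p2, mul_nonneg hM0 p1]
  linarith

end Deterministic
-- Pathwise bound for the stopping time.
section Deterministic

variable {K : ℕ} {I : Type*} {E : ExpFamily} {Q : Problem K I} {σ μmin μmax DK : ℝ}
  {a : ℕ → Fin K} {x : ℕ → ℝ}

/-- The stopping time exceeds a time that satisfies the condition in `T0` only because of the rounds
in which the true model is not in the confidence region. -/
lemma stopTime_le_add_tsum [Finite I] [LinearOrder I] (hσ : 0 < σ) (hE : E.SubGaussian σ)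
    (hΘ : Set.Icc μmin μmax ⊆ E.Θ) (hK : 1 ≤ K) (hDK : 1 ≤ DK)
    (hM : ∀ l ∈ Q.M, ∀ k, l k ∈ Set.Icc μmin μmax) {μ : Fin K → ℝ} (hμ : μ ∈ Q.M) {ε : ℝ}
    (hε : 0 < ε) (hiF : ∀ μ' ∈ Q.M, dist μ μ' ≤ ε → iF E Q μ' ⊆ iF E Q μ ∪ (Q.iStar μ)ᶜ)
    (hfollow : FollowsStickyTaS E Q μmin μmax DK a x) {b : ℕ → ℝ} (hb : ∀ t, 0 ≤ b t)
    (hb' : ∀ s t : ℕ, 3 ≤ s → s ≤ t → b t / t ≤ b s / s) {t₀ : ℕ} (ht₀ : 1 ≤ t₀)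
    (hbt₀ : b t₀ ≤ (t₀ - √(t₀ : ℝ) - 1 - Tmu K σ DK ε) * (invTStar E Q μ).toReal
      - lowerOrder (lowerOrderConst E σ μmin μmax) K DK t₀) {f : ℕ → ℝ≥0∞}
    (hf : ∀ s : ℕ, 2 * K ≤ s → ¬ ∑ k, (pulls a k s : ℝ≥0∞) * E.d (empMean a x s k) (μ k)
      ≤ ENNReal.ofReal (DK * Real.log s) → (s : ℝ≥0∞) ^ 2 + 1 ≤ f s) :
    stopTime E Q b a x ≤ t₀ + ∑' s, f s := by
  set T := Tmu K σ DK ε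
  set R := (invTStar E Q μ).toReal
  set g := lowerOrder (lowerOrderConst E σ μmin μmax) K DK
  have hC := lowerOrderConst_pos E hσ μmin μmax
  have hR0 : 0 ≤ R := ENNReal.toReal_nonneg
  have hg0 : 0 < g t₀ := lowerOrder_pos hC K (by linarith) ht₀
  -- Since b ≥ 0 and g(t₀) > 0 strictly, the factor of T*(μ)⁻¹ must be positive.
  have hT : (T : ℝ) < t₀ - √(t₀ : ℝ) - 1 := by
    by_contra! hc
    have := mul_nonneg (sub_nonneg.2 hc) hR0
    linarith [hb t₀]
  have hT10 : 10 * K ^ 4 ≤ T := le_max_left _ _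
  have hTt₀ : T < t₀ := by
    have : (T : ℝ) < t₀ := by linarith [Real.sqrt_nonneg (t₀ : ℝ)]
    exact_mod_cast this
  have hK4 : K ^ 2 ≤ K ^ 4 := Nat.pow_le_pow_right hK (by norm_num)
  have hK2 : 1 ≤ K ^ 2 := Nat.one_le_pow _ _ hK
  have hsuff : ∀ t : ℕ, t₀ ≤ t → (∀ s : ℕ, √(t : ℝ) ≤ s → s ≤ t →
      ∑ k, (pulls a k s : ℝ≥0∞) * E.d (empMean a x s k) (μ k) ≤ ENNReal.ofReal (DK * Real.log s)) →
      stopTime E Q b a x ≤ t := by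
    intro t htt hgood
    have htt' : (t₀ : ℝ) ≤ t := by exact_mod_cast htt
    have hp₀ : (0 : ℝ) < t₀ := by exact_mod_cast ht₀
    have hp : (0 : ℝ) < t := by linarith
    have hs : √(t₀ : ℝ) ≤ √(t : ℝ) := Real.sqrt_le_sqrt htt'
    have hs0 : 0 ≤ √(t₀ : ℝ) := Real.sqrt_nonneg _
    have hq₀ : √(t₀ : ℝ) * √(t₀ : ℝ) = t₀ := Real.mul_self_sqrt hp₀.le
    have hq : √(t : ℝ) * √(t : ℝ) = t := Real.mul_self_sqrt hp.le
    have hmono : (t₀ - √(t₀ : ℝ) - 1 - T) / t₀ ≤ (t - √(t : ℝ) - 1 - T) / t := by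
      rw [div_le_div_iff₀ hp₀ hp]
      have h1 : √(t : ℝ) * t₀ ≤ √(t₀ : ℝ) * t := by
        have := mul_le_mul_of_nonneg_left hs (mul_nonneg hs0 (Real.sqrt_nonneg (t : ℝ)))
        calc √(t : ℝ) * t₀ = √(t₀ : ℝ) * √(t : ℝ) * √(t₀ : ℝ) := by
              rw [mul_right_comm, hq₀, mul_comm]
          _ ≤ √(t₀ : ℝ) * √(t : ℝ) * √(t : ℝ) := this
          _ = √(t₀ : ℝ) * t := by rw [mul_assoc, hq]
      nlinarith [T.cast_nonneg (α := ℝ)]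
    have hpos : 0 < (t₀ - √(t₀ : ℝ) - 1 - T) / t₀ := div_pos (by linarith) hp₀
    have hTt : (T : ℝ) < t - √(t : ℝ) - 1 := by
      have := (div_pos_iff_of_pos_right hp).1 (hpos.trans_le hmono)
      linarith
    have hbt : b t ≤ (t - √(t : ℝ) - 1 - T) * R - g t := by
      have h1 := hb' t₀ t (by omega) htt
      have h2 : b t₀ / t₀ ≤ (t₀ - √(t₀ : ℝ) - 1 - T) / t₀ * R - g t₀ / t₀ := by
        rw [div_mul_eq_mul_div, ← sub_div]
        gcongr
      have h3 := mul_le_mul_of_nonneg_right hmono hR0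
      have h4 : g t / t ≤ g t₀ / t₀ := lowerOrder_div_antitone hC.le (by linarith) ht₀ htt
      have h5 : b t / t ≤ ((t - √(t : ℝ) - 1 - T) * R - g t) / t := by
        rw [sub_div, ← div_mul_eq_mul_div]
        linarith
      exact (div_le_div_iff_of_pos_right hp).1 h5
    refine iInf₂_le t ⟨by nlinarith, (ENNReal.ofReal_le_ofReal hbt).trans ?_⟩
    exact ofReal_le_stopStat hσ hE hΘ hK hDK hM hμ hε hiF hfollow hTt hgood
  have hwindow : ∀ s t : ℕ, t₀ ≤ t → √(t : ℝ) ≤ s → t ≤ s ^ 2 ∧ 2 * K ≤ s := by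
    intro s t htt hs
    have h1 : (t : ℝ) ≤ (s : ℝ) ^ 2 := (Real.sqrt_le_left s.cast_nonneg).1 hs
    have h2 : t ≤ s ^ 2 := by exact_mod_cast h1
    refine ⟨h2, ?_⟩
    by_contra! hc
    nlinarith
  -- Each bad round s ≥ 2K contributes at least 1, so a finite sum leaves finitely many of them.
  by_cases hfin : ∑' s, f s = ∞
  · simp [hfin]
  set B : Set ℕ := {s | 2 * K ≤ s ∧ ¬ ∑ k, (pulls a k s : ℝ≥0∞) *
    E.d (empMean a x s k) (μ k) ≤ ENNReal.ofReal (DK * Real.log s)}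
  have hB : B.Finite := (ENNReal.finite_const_le_of_tsum_ne_top hfin one_ne_zero).subset
    fun s hs => le_add_self.trans (hf s hs.1 hs.2)
  rcases B.eq_empty_or_nonempty with hemp | hne
  · refine (hsuff t₀ le_rfl fun s hs _ => ?_).trans le_self_add
    by_contra hc
    obtain ⟨-, h1⟩ := hwindow s t₀ le_rfl hs
    exact (hemp ▸ (⟨h1, hc⟩ : s ∈ B) : s ∈ (∅ : Set ℕ))
  · obtain ⟨s, hs, hmax⟩ := Set.exists_max_image B id hB hne
    -- Any r in the window has r² ≥ t₀ + s² + 1 > s², hence lies beyond the last bad round s.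
    have h := hsuff (t₀ + (s ^ 2 + 1)) (by omega) fun r hr _ => by
      by_contra hc
      obtain ⟨h0, h1⟩ := hwindow r _ (by omega) hr
      have hrs : r ≤ s := hmax r ⟨h1, hc⟩
      have := Nat.pow_le_pow_left hrs 2
      omega
    refine h.trans ?_
    push_cast
    gcongr
    exact (hf s hs.1 hs.2).trans (ENNReal.le_tsum s)

lemma stopTime_le_of_alt_eq_empty {i : I} (hi : Q.alt i = ∅) (b : ℕ → ℝ) :
    stopTime E Q b a x ≤ K :=
  iInf₂_le K ⟨le_rfl, by rw [stopStat_eq_top hi]; exact le_top⟩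

end Deterministic

/-! ### Expected cost of the bad rounds and conclusion. -/

lemma tsum_sq_add_one_mul_le :
    ∑' s : ℕ, ((s : ℝ≥0∞) ^ 2 + 1) * ENNReal.ofReal (1 / (s : ℝ) ^ 4) ≤ ENNReal.ofReal 10 := by
  have h : HasSum (fun n : ℕ => 1 / (n : ℝ) ^ 2) (Real.pi ^ 2 / 6) := hasSum_zeta_two
  have h2 := h.mul_left 2
  calc _ ≤ ∑' s : ℕ, ENNReal.ofReal (2 * (1 / (s : ℝ) ^ 2)) := by
        refine ENNReal.tsum_le_tsum fun s => ?_
        have e : (s : ℝ≥0∞) ^ 2 + 1 = ENNReal.ofReal ((s : ℝ) ^ 2 + 1) := by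
          rw [ENNReal.ofReal_add (by positivity) zero_le_one, ENNReal.ofReal_pow s.cast_nonneg]
          simp
        rw [e, ← ENNReal.ofReal_mul (by positivity)]
        refine ENNReal.ofReal_le_ofReal ?_
        rcases s.eq_zero_or_pos with rfl | hs
        · simp
        have hs1 : (1 : ℝ) ≤ (s : ℝ) ^ 2 := one_le_pow₀ (by exact_mod_cast hs)
        have hs0 : (0 : ℝ) < s := by exact_mod_cast hs
        calc ((s : ℝ) ^ 2 + 1) * (1 / (s : ℝ) ^ 4)
            ≤ ((s : ℝ) ^ 2 + (s : ℝ) ^ 2) * (1 / (s : ℝ) ^ 4) := by gcongr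
          _ = _ := by field_simp; ring
    _ = ENNReal.ofReal (2 * (Real.pi ^ 2 / 6)) := by
        rw [← ENNReal.ofReal_tsum_of_nonneg (fun n => by positivity) h2.summable, h2.tsum_eq]
    _ ≤ _ := by
        refine ENNReal.ofReal_le_ofReal ?_
        nlinarith [Real.pi_le_four, Real.pi_pos]

end StickyTaS

theorem theorem2 :
    -- the constant `D_K` is any number above a bound that depends on `K` only
    ∃ D₀ : ℕ → ℝ, (∀ K, 1 ≤ D₀ K) ∧
    ∀ (E : ExpFamily) (σ μmin μmax : ℝ), 0 < σ → E.SubGaussian σ → Set.Icc μmin μmax ⊆ E.Θ →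
    -- the constant and the logarithmic power hidden in the order of `g`
    ∃ (C : ℝ) (p : ℕ), ∀ K : ℕ, 1 ≤ K → ∀ DK : ℝ, D₀ K ≤ DK →
    ∃ g : ℕ → ℝ,
      (∀ t : ℕ, 1 ≤ t → 0 ≤ g t ∧
        g t ≤ C * (1 + Real.log (K * t)) ^ p *
          ((K : ℝ) ^ 2 * √(DK * t) + √(DK * (t : ℝ) ^ (3 / 2 : ℝ)))) ∧
      ∀ {I : Type*} [Fintype I] [LinearOrder I] (Q : Problem K I),
        (∀ l ∈ Q.M, ∀ k, l k ∈ Set.Icc μmin μmax) →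
      ∀ μ ∈ Q.M, ∀ ε : ℝ, 0 < ε →
        (∀ μ' ∈ Q.M, dist μ μ' ≤ ε → iF E Q μ' ⊆ iF E Q μ ∪ (Q.iStar μ)ᶜ) →
      ∀ β : ℕ → ℝ → ℝ, IsThreshold β → ∀ δ ∈ Set.Ioo (0 : ℝ) 1,
      ∀ {Ω : Type*} {mΩ : MeasurableSpace Ω} (P : Measure Ω) [IsProbabilityMeasure P]
        (ℱ : Filtration ℕ mΩ) (A : ℕ → Ω → Fin K) (X : ℕ → Ω → ℝ),
        IsInteraction P (fun k => E.law (μ k)) ℱ A X →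
        (∀ᵐ ω ∂P, FollowsStickyTaS E Q μmin μmax DK (fun t => A t ω) (fun t => X t ω)) →
        ∫⁻ ω, stopTime E Q (fun t => β t δ) (fun t => A t ω) (fun t => X t ω) ∂P
          ≤ ENNReal.ofReal (10 * (K : ℝ) ^ 4 + Real.pi ^ 2 / 24)
            + T0 (fun t => β t δ) g (Tmu K σ DK ε) (invTStar E Q μ) := by
  -- 6K serves the concentration bound; the 1 ensures D₀ ≥ 1 even at K = 0.
  refine ⟨fun K => 6 * K + 1, fun K => by simp, ?_⟩
  intro E σ μmin μmax hσ hE hΘ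
  have hC := lowerOrderConst_pos E hσ μmin μmax
  refine ⟨2 * lowerOrderConst E σ μmin μmax, 1, fun K hK DK hDK =>
    ⟨lowerOrder (lowerOrderConst E σ μmin μmax) K DK, fun t ht => ?_, ?_⟩⟩
  · have : 0 < DK := lt_of_lt_of_le (by positivity) hDK
    exact ⟨(lowerOrder_pos hC K this ht).le, lowerOrder_le hC.le hK ht⟩
  intro I _ _ Q hM μ hμ ε hε hiF β hβ δ hδ Ω mΩ P _ ℱ A X hint hfollow
  have hK1 : (1 : ℝ) ≤ K := by exact_mod_cast hK
  have hDK1 : 1 ≤ DK := le_trans (by simp) hDK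
  have hμΘ : ∀ k, μ k ∈ E.Θ := fun k => hΘ (hM μ hμ k)
  have hK4 : (K : ℝ) ≤ (K : ℝ) ^ 4 := le_self_pow₀ hK1 (by norm_num)
  have hπ : 0 ≤ Real.pi ^ 2 / 24 := by positivity
  -- An infinite T*(μ)⁻¹ means that some answer has no alternative; the statistic is then infinite
  -- and the algorithm stops at time K.
  by_cases hR : invTStar E Q μ = ∞
  · obtain ⟨i, hi⟩ := exists_alt_eq_empty hΘ hM hμ hR
    calc _ ≤ ∫⁻ _ω, (K : ℝ≥0∞) ∂P := lintegral_mono fun ω => stopTime_le_of_alt_eq_empty hi _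
      _ = ENNReal.ofReal K := by simp
      _ ≤ ENNReal.ofReal (10 * (K : ℝ) ^ 4 + Real.pi ^ 2 / 24) :=
          ENNReal.ofReal_le_ofReal (by linarith)
      _ ≤ _ := le_self_add
  simp only [T0, ENNReal.add_iInf]
  refine le_iInf₂ fun t₀ ht₀ => ?_
  obtain ⟨ht1, ht₀⟩ := ht₀
  rw [← EReal.coe_ennreal_toReal hR, ← EReal.coe_mul, ← EReal.coe_sub, EReal.coe_le_coe_iff] at ht₀
  set B : ℕ → Set Ω := fun s => {ω | ¬ ∑ k, (pulls (fun t => A t ω) k s : ℝ≥0∞) *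
    E.d (empMean (fun t => A t ω) (fun t => X t ω) s k) (μ k) ≤ ENNReal.ofReal (DK * Real.log s)}
  -- Measurable hulls keep the probabilities and avoid proving the bad events measurable.
  set S : ℕ → Set Ω := fun s => if 2 * K ≤ s then toMeasurable P (B s) else ∅
  have hS : ∀ s, MeasurableSet (S s) := fun s => by
    simp only [S]
    split_ifs
    · exact measurableSet_toMeasurable _ _
    · exact .empty
  have hPS : ∀ s, P (S s) ≤ ENNReal.ofReal (1 / (s : ℝ) ^ 4) := fun s => by
    simp only [S]
    split_ifs with hs
    · rw [measure_toMeasurable]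
      exact measure_not_sum_le hμΘ hint (by linarith) hK hs
    · simp
  have hpath : ∀ᵐ ω ∂P, stopTime E Q (fun t => β t δ) (fun t => A t ω) (fun t => X t ω)
      ≤ t₀ + ∑' s : ℕ, (S s).indicator (fun _ => (s : ℝ≥0∞) ^ 2 + 1) ω := by
    filter_upwards [hfollow] with ω hω
    refine stopTime_le_add_tsum hσ hE hΘ hK hDK1 hM hμ hε hiF hω (hβ.nonneg δ hδ)
      (hβ.antitone δ hδ) ht1 ht₀ fun s hs hbad => ?_
    have hmem : ω ∈ S s := by
      simp only [S, if_pos hs]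
      exact subset_toMeasurable P (B s) hbad
    rw [Set.indicator_of_mem hmem]
  calc _ ≤ ∫⁻ ω, (t₀ + ∑' s : ℕ, (S s).indicator (fun _ => (s : ℝ≥0∞) ^ 2 + 1) ω) ∂P :=
        lintegral_mono_ae hpath
    _ = t₀ + ∑' s : ℕ, ((s : ℝ≥0∞) ^ 2 + 1) * P (S s) := by
        rw [lintegral_add_left measurable_const,
          lintegral_tsum fun s => (measurable_const.indicator (hS s)).aemeasurable]
        simp [lintegral_indicator_const (hS _)]
    _ ≤ t₀ + ∑' s : ℕ, ((s : ℝ≥0∞) ^ 2 + 1) * ENNReal.ofReal (1 / (s : ℝ) ^ 4) := by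
        gcongr with s
        exact hPS s
    _ ≤ t₀ + ENNReal.ofReal 10 := by gcongr; exact tsum_sq_add_one_mul_le
    _ ≤ t₀ + ENNReal.ofReal (10 * (K : ℝ) ^ 4 + Real.pi ^ 2 / 24) := by
        gcongr
        linarith
    _ = _ := add_comm _ _
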